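/- Let $q\in(0,1)$, $\mathsf{s}\in(-1,0)$, $\xi>0$ and $0\le c<1$, and write $(z;q)_j=\prod_{i=0}^{j-1}(1-zq^i)$, $(z;q)_\infty=\prod_{i\ge0}(1-zq^i)$. The homogeneous half-continuous stochastic higher spin six vertex model on $\mathbb{Z}$ is the continuous time Markov process on configurations $\eta\in\{0,1,2,\ldots\}^{\mathbb{Z}}$ ($\eta(i)$ is the number of particles at $i$) in which, independently for every $i\in\mathbb{Z}$, a particle wakes up at $i$ at rate $\xi(-\mathsf{s})(1-q^{\eta(i)})$ and then instantaneously jumps to a location $j>i$ chosen with probability $$\Big(\prod_{k=i+1}^{j-1}\mathsf{s}^2q^{\eta(k)}\Big)\big(1-\mathsf{s}^2q^{\eta(j)}\big),$$ where $\eta$ is the configuration just before the jump. Precisely, its transition kernels $(P_t)_{t\ge0}$ form a semigroup of Markov kernels on $\{0,1,2,\ldots\}^{\mathbb{Z}}$, with $P_0=\mathrm{id}$, such that for all $\eta$, all $t\ge0$ and every bounded function $f$ depending on finitely many coordinates, $\frac{d}{dt}P_tf(\eta)=P_t(Lf)(\eta)$, where $Lf(\eta)=\sum_{i<j}r_{ij}(\eta)\,(f(\eta^{i\to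 j})-f(\eta))$, $r_{ij}(\eta)$ is the product of the wake-up rate at $i$ and the above probability, and $\eta^{i\to j}$ is $\eta$ with one particle moved from $i$ to $j$. Then such a semigroup exists and is unique; the numbers $$\varphi_{c,\mathsf{s}^2}(j)=c^j\,\frac{(\mathsf{s}^2;q)_j}{(q;q)_j}\,\frac{(c;q)_\infty}{(c\,\mathsf{s}^2;q)_\infty},\qquad j=0,1,2,\ldots,$$ form a probability distribution; and the product measure $\mathfrak{m}=(\varphi_{c,\mathsf{s}^2})^{\otimes\mathbb{Z}}$ (i.i.d. numbers of particles at all locations, with law $\varphi_{c,\mathsf{s}^2}$) is stationary for the process: $\mathfrak{m}P_t=\mathfrak{m}$ for all $t\ge0$. -/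

import Mathlib

open MeasureTheory ProbabilityTheory
open scoped NNReal

noncomputable section

namespace HalfContinuousVertex

/-- The finite `q`-Pochhammer symbol `(z; q)_m = ∏_{i < m} (1 - z q^i)`. -/
def qPochhammer (q z : ℝ) (m : ℕ) : ℝ :=
  ∏ i ∈ Finset.range m, (1 - z * q ^ i)

/-- The infinite `q`-Pochhammer symbol `(z; q)_∞ = ∏_{i ≥ 0} (1 - z q^i)`. -/
def qPochhammerInf (q z : ℝ) : ℝ :=
  ∏' i : ℕ, (1 - z * q ^ i)

/-- The one-site weights `φ_{c,s²}(j)`. -/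
def siteWeight (q s c : ℝ) (j : ℕ) : ℝ :=
  c ^ j * (qPochhammer q (s ^ 2) j / qPochhammer q q j) *
    (qPochhammerInf q c / qPochhammerInf q (c * s ^ 2))

/-- The one-site measure on `{0, 1, 2, …}` with mass `φ_{c,s²}(j)` at `j`. -/
def siteMeasure (q s c : ℝ) : Measure ℕ :=
  Measure.sum fun j => ENNReal.ofReal (siteWeight q s c j) • Measure.dirac j

/-- Particle configurations on `ℤ`: `η i` is the (finite) number of particles at `i`.
It carries the product σ-algebra. -/
abbrev Config : Type := ℤ → ℕ

/-- The product measure with i.i.d. marginals `φ_{c,s²}`. -/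
def productMeasure (q s c : ℝ) : Measure Config :=
  Measure.infinitePi fun _ : ℤ => siteMeasure q s c

/-- The rate at which a particle leaves the stack at `i`. -/
def wakeUpRate (q s ξ : ℝ) (η : Config) (i : ℤ) : ℝ :=
  ξ * (-s) * (1 - q ^ η i)

/-- The probability that a particle which wakes up at `i` ends exactly at `j`, given the
configuration `η` just before the jump. -/
def landingProb (q s : ℝ) (η : Config) (i j : ℤ) : ℝ :=
  if i < j then (∏ k ∈ Finset.Ioo i j, s ^ 2 * q ^ η k) * (1 - s ^ 2 * q ^ η j) else 0

/-- The configuration after one particle has moved from `i` to `j` (used only for `i < j`,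
and with a positive rate only if `η i ≥ 1`). -/
def moveParticle (η : Config) (i j : ℤ) : Config := fun k =>
  if k = i then η k - 1 else if k = j then η k + 1 else η k

/-- The generator of the homogeneous half-continuous vertex model on `ℤ`:
the sum over all ordered pairs of sites `(i, j)` of the jump rate from `i` to `j` times the
increment of `f`. -/
def generator (q s ξ : ℝ) (f : Config → ℝ) (η : Config) : ℝ :=
  ∑' p : ℤ × ℤ, wakeUpRate q s ξ η p.1 * landingProb q s η p.1 p.2 *
    (f (moveParticle η p.1 p.2) - f η)

/-- Bounded functions that depend on finitely many sites only. -/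
def IsBoundedCylinder (f : Config → ℝ) : Prop :=
  (∃ C : ℝ, ∀ η, |f η| ≤ C) ∧ ∃ B : Finset ℤ, DependsOn f (B : Set ℤ)

/-- `P t η` is the law at time `t` of the homogeneous half-continuous vertex model on `ℤ` started
from `η`: `P` is a semigroup of Markov kernels on configurations, and on bounded cylinder
functions its time evolution is given by the jump rates of the model. -/
structure IsTransitionSemigroup (q s ξ : ℝ) (P : ℝ≥0 → Kernel Config Config) : Prop where
  markov : ∀ t, IsMarkovKernel (P t)
  zero : P 0 = Kernel.id
  add : ∀ t u, P (t + u) = P t ∘ₖ P u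
  forward : ∀ f : Config → ℝ, IsBoundedCylinder f → ∀ (η : Config) (t : ℝ≥0),
    HasDerivWithinAt (fun u : ℝ => ∫ ζ, f ζ ∂(P u.toNNReal η))
      (∫ ζ, generator q s ξ f ζ ∂(P t η)) (Set.Ici 0) t

end HalfContinuousVertex

end

/-! Normalisation is the `q`-binomial theorem (`qBinomial_theorem`): iterate the `q`-difference
equation of the series and let `q ^ n * c` tend to `0`.

The process is built from finite systems in which only jumps inside `box M` are allowed. Their
generators are bounded, so their semigroups are exponential series. With `ρ = -s` and `a = ξ *
(-s)`, a jump across `g` intermediate sites has rate at most `a * ρ ^ (2 * g)`. Half of this decay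
pays for comparing the site weights `ρ⁻¹ ^ |l|`; the other half keeps the sum over jumps finite.
Consequently the weighted influence, the sum over `l` of `ρ⁻¹ ^ |l| * ‖incr l f‖`, grows at most
exponentially in time with a constant independent of `M` (`influence_euler_le`,
`influence_boxSemigroup_le`), while truncating to `box M` costs only `O(ρ ^ M)` times the influence
(`norm_genOn_sub_le`, `abs_genAll_sub_le`).

A Duhamel argument turns these two facts into one comparison principle
(`functional_eq_limitSemigroup`): every contractive family of functionals solving the forward
equation on cylinder observables is given by the limit of the box semigroups. The same comparison
gives convergence of the finite systems, uniqueness of the semigroup, and invariance of any measure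
that is infinitesimally invariant in the limit. Configuration space is not compact, so the kernels
themselves come from tightness: the box semigroups are integrals against probability measures
(`exists_boxMeasure`), and particle counts are bounded in mean uniformly in `M`
(`exists_limitMeasure`).

For stationarity, the weight recursion `siteWeight_succ` turns a forward jump under the product
measure into multiplication by a reversed rate (`integral_jumpRate_mul_jumpObs`). Reversed minus
forward rates telescope over the box to fluxes through its two ends (`sum_reversed_sub_rates`).
These fluxes do not vanish, since the stationary system carries a current. For `f` supported in `box
m`, however, sources beyond the support balance exactly by reflecting the sites outside `box m`, and
the remaining sources must cross `M - m` sites, which costs `(s ^ 2) ^ (M - m)`. -/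

noncomputable section

namespace HalfContinuousVertex

open Filter Topology

/-! ### The q-binomial theorem -/

section QBinomial

variable {q : ℝ}

theorem summable_qPow_mul (hq : 0 < q ∧ q < 1) (z : ℝ) :
    Summable fun i : ℕ => ‖-(z * q ^ i)‖ := by
  simpa [abs_mul, abs_of_pos hq.1] using
    (summable_geometric_of_lt_one hq.1.le hq.2).mul_left |z|

theorem tendsto_qPochhammer (hq : 0 < q ∧ q < 1) (z : ℝ) :
    Tendsto (qPochhammer q z) atTop (𝓝 (qPochhammerInf q z)) := by
  have h := (multipliable_one_add_of_summable (summable_qPow_mul hq z)).hasProd.tendsto_prod_nat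
  simpa [qPochhammer, qPochhammerInf, sub_eq_add_neg] using! h

theorem one_sub_mul_qPow_pos (hq : 0 < q ∧ q < 1) {z : ℝ} (hz : z < 1) (i : ℕ) :
    0 < 1 - z * q ^ i := by
  have h1 : 0 < q ^ i := pow_pos hq.1 i
  have h2 : q ^ i ≤ 1 := pow_le_one₀ hq.1.le hq.2.le
  rcases le_or_gt z 0 with h | h <;> nlinarith

theorem qPochhammer_pos (hq : 0 < q ∧ q < 1) {z : ℝ} (hz : z < 1) (n : ℕ) :
    0 < qPochhammer q z n :=
  Finset.prod_pos fun i _ => one_sub_mul_qPow_pos hq hz i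

/-- A limit of positive partial products is only nonnegative; strictness comes from absolute
convergence with no vanishing factor. -/
theorem qPochhammerInf_pos (hq : 0 < q ∧ q < 1) {z : ℝ} (hz : z < 1) :
    0 < qPochhammerInf q z := by
  refine lt_of_le_of_ne (ge_of_tendsto' (tendsto_qPochhammer hq z)
    fun n => (qPochhammer_pos hq hz n).le) (Ne.symm ?_)
  have := tprod_one_add_ne_zero_of_summable (f := fun i : ℕ => -(z * q ^ i))
    (fun i => by have := one_sub_mul_qPow_pos hq hz i; simpa [sub_eq_add_neg] using! this.ne')
    (summable_qPow_mul hq z)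
  simpa [qPochhammerInf, sub_eq_add_neg] using this

theorem qPochhammer_succ (q z : ℝ) (n : ℕ) :
    qPochhammer q z (n + 1) = qPochhammer q z n * (1 - z * q ^ n) :=
  Finset.prod_range_succ _ _

/-- The coefficients of the `q`-binomial series. -/
def qBinomialCoeff (q z : ℝ) (j : ℕ) : ℝ := qPochhammer q z j / qPochhammer q q j

theorem qBinomialCoeff_pos (hq : 0 < q ∧ q < 1) {z : ℝ} (hz : z < 1) (j : ℕ) :
    0 < qBinomialCoeff q z j :=
  div_pos (qPochhammer_pos hq hz j) (qPochhammer_pos hq hq.2 j)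

theorem qBinomialCoeff_succ (hq : 0 < q ∧ q < 1) (z : ℝ) (j : ℕ) :
    qBinomialCoeff q z (j + 1) * (1 - q ^ (j + 1)) = qBinomialCoeff q z j * (1 - z * q ^ j) := by
  have h2 := (one_sub_mul_qPow_pos hq hq.2 j).ne'
  rw [qBinomialCoeff, qBinomialCoeff, qPochhammer_succ, qPochhammer_succ, pow_succ',
    div_mul_eq_mul_div, mul_div_mul_right _ _ h2, div_mul_eq_mul_div]

theorem qPochhammer_antitone (hq : 0 < q ∧ q < 1) {z : ℝ} (h0 : 0 ≤ z) (hz : z < 1) :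
    Antitone (qPochhammer q z) :=
  antitone_nat_of_succ_le fun n => by
    rw [qPochhammer_succ]
    refine mul_le_of_le_one_right (qPochhammer_pos hq hz n).le ?_
    have := mul_nonneg h0 (pow_pos hq.1 n).le
    linarith

/-- The numerator Pochhammer is at most `1` and the denominator at least its limit `(q; q)_∞`, so
the coefficients are bounded and a geometric series dominates. -/
theorem summable_qBinomial (hq : 0 < q ∧ q < 1) {z : ℝ} (h0 : 0 ≤ z) (hz : z < 1) {c : ℝ}
    (hc : 0 ≤ c ∧ c < 1) : Summable fun j => qBinomialCoeff q z j * c ^ j := by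
  refine Summable.of_nonneg_of_le
    (fun j => mul_nonneg (qBinomialCoeff_pos hq hz j).le (pow_nonneg hc.1 j)) (fun j => ?_)
    ((summable_geometric_of_lt_one hc.1 hc.2).mul_left (1 / qPochhammerInf q q))
  gcongr
  · exact pow_nonneg hc.1 j
  · refine div_le_div₀ zero_le_one ?_ (qPochhammerInf_pos hq hq.2) ?_
    · simpa [qPochhammer] using qPochhammer_antitone hq h0 hz (Nat.zero_le j)
    · exact (qPochhammer_antitone hq hq.1.le hq.2).le_of_tendsto (tendsto_qPochhammer hq q) j

/-- The `q`-difference equation of the `q`-binomial series. -/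
theorem qBinomial_functional (hq : 0 < q ∧ q < 1) {z : ℝ} (h0 : 0 ≤ z) (hz : z < 1) {c : ℝ}
    (hc : 0 ≤ c ∧ c < 1) :
    (1 - c) * ∑' j, qBinomialCoeff q z j * c ^ j =
      (1 - z * c) * ∑' j, qBinomialCoeff q z j * (q * c) ^ j := by
  have hqc : 0 ≤ q * c ∧ q * c < 1 :=
    ⟨mul_nonneg hq.1.le hc.1, by nlinarith [mul_nonneg hq.1.le hc.1, hc.1, hq.1]⟩
  have s1 := summable_qBinomial hq h0 hz hc
  have s2 := summable_qBinomial hq h0 hz hqc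
  have e1 : ∑' j, (qBinomialCoeff q z j * c ^ j - qBinomialCoeff q z j * (q * c) ^ j) =
      ∑' j, (c * (qBinomialCoeff q z j * c ^ j) - z * c * (qBinomialCoeff q z j * (q * c) ^ j)) := by
    -- The constant terms of the series at `c` and at `q * c` cancel; after the index shift the
    -- coefficient recursion applies termwise.
    rw [(s1.sub s2).tsum_eq_zero_add]
    simp only [pow_zero, mul_one, sub_self, zero_add]
    refine tsum_congr fun j => ?_
    have h := qBinomialCoeff_succ hq z j
    calc _ = c ^ (j + 1) * (qBinomialCoeff q z (j + 1) * (1 - q ^ (j + 1))) := by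
          rw [mul_pow]; ring
      _ = _ := by rw [h, mul_pow]; ring
  rw [s1.tsum_sub s2, (s1.mul_left c).tsum_sub (s2.mul_left (z * c)), tsum_mul_left,
    tsum_mul_left] at e1
  linarith

/-- The `q`-binomial theorem. -/
theorem qBinomial_theorem (hq : 0 < q ∧ q < 1) {z : ℝ} (h0 : 0 ≤ z) (hz : z < 1) {c : ℝ}
    (hc : 0 ≤ c ∧ c < 1) :
    qPochhammerInf q c * ∑' j, qBinomialCoeff q z j * c ^ j = qPochhammerInf q (c * z) := by
  have hcn : ∀ n : ℕ, 0 ≤ q ^ n * c ∧ q ^ n * c < 1 := fun n =>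
    ⟨mul_nonneg (pow_pos hq.1 n).le hc.1,
      (mul_le_of_le_one_left hc.1 (pow_le_one₀ hq.1.le hq.2.le)).trans_lt hc.2⟩
  have it : ∀ n : ℕ, qPochhammer q c n * ∑' j, qBinomialCoeff q z j * c ^ j =
      qPochhammer q (c * z) n * ∑' j, qBinomialCoeff q z j * (q ^ n * c) ^ j := by
    intro n
    induction n with
    | zero => simp [qPochhammer]
    | succ n ih =>
      have h := qBinomial_functional hq h0 hz (hcn n)
      rw [← mul_assoc q, ← pow_succ'] at h
      rw [qPochhammer_succ, qPochhammer_succ, mul_right_comm, ih]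
      linear_combination qPochhammer q (c * z) n * h
  have hlim : Tendsto (fun n : ℕ => ∑' j, qBinomialCoeff q z j * (q ^ n * c) ^ j) atTop
      (𝓝 (∑' j, qBinomialCoeff q z j * (0 : ℝ) ^ j)) := by
    refine tendsto_tsum_of_dominated_convergence (summable_qBinomial hq h0 hz hc) (fun j => ?_)
      (Eventually.of_forall fun n j => ?_)
    · have : Tendsto (fun n : ℕ => q ^ n * c) atTop (𝓝 (0 * c)) :=
        (tendsto_pow_atTop_nhds_zero_of_lt_one hq.1.le hq.2).mul_const c
      simpa using (this.pow j).const_mul (qBinomialCoeff q z j)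
    · have hb := (qBinomialCoeff_pos hq hz j).le
      rw [Real.norm_of_nonneg (mul_nonneg hb (pow_nonneg (hcn n).1 j))]
      gcongr
      · exact (hcn n).1
      · exact mul_le_of_le_one_left hc.1 (pow_le_one₀ hq.1.le hq.2.le)
  have hzero : ∑' j, qBinomialCoeff q z j * (0 : ℝ) ^ j = 1 := by
    rw [tsum_eq_single 0 (fun j hj => by simp [hj])]
    simp [qBinomialCoeff, qPochhammer]
  rw [hzero] at hlim
  have := tendsto_nhds_unique ((tendsto_qPochhammer hq c).mul_const _)
    (((tendsto_qPochhammer hq (c * z)).mul hlim).congr fun n => (it n).symm)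
  simpa using this

end QBinomial

/-! ### The one-site distribution and its recursion -/

section SiteMeasure

variable {q s c : ℝ}

theorem siteWeight_eq (q s c : ℝ) (j : ℕ) : siteWeight q s c j =
    (qPochhammerInf q c / qPochhammerInf q (c * s ^ 2)) * (qBinomialCoeff q (s ^ 2) j * c ^ j) := by
  rw [siteWeight, qBinomialCoeff]; ring

theorem sq_lt_one_of_mem (hs : -1 < s ∧ s < 0) : s ^ 2 < 1 := by nlinarith

theorem mul_sq_lt_one (hs : -1 < s ∧ s < 0) (hc : 0 ≤ c ∧ c < 1) : c * s ^ 2 < 1 :=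
  (mul_le_of_le_one_right hc.1 (sq_lt_one_of_mem hs).le).trans_lt hc.2

theorem siteWeight_nonneg (hq : 0 < q ∧ q < 1) (hs : -1 < s ∧ s < 0) (hc : 0 ≤ c ∧ c < 1) (j : ℕ) :
    0 ≤ siteWeight q s c j := by
  rw [siteWeight_eq]
  have h1 := qPochhammerInf_pos hq hc.2
  have h2 := qPochhammerInf_pos hq (mul_sq_lt_one hs hc)
  have h3 := qBinomialCoeff_pos hq (sq_lt_one_of_mem hs) j
  have h4 := pow_nonneg hc.1 j
  positivity

theorem hasSum_siteWeight (hq : 0 < q ∧ q < 1) (hs : -1 < s ∧ s < 0) (hc : 0 ≤ c ∧ c < 1) :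
    HasSum (siteWeight q s c) 1 := by
  have h := (summable_qBinomial hq (sq_nonneg s) (sq_lt_one_of_mem hs) hc).hasSum.mul_left
    (qPochhammerInf q c / qPochhammerInf q (c * s ^ 2))
  rw [div_mul_eq_mul_div, qBinomial_theorem hq (sq_nonneg s) (sq_lt_one_of_mem hs) hc,
    div_self (qPochhammerInf_pos hq (mul_sq_lt_one hs hc)).ne'] at h
  simpa only [← siteWeight_eq] using h

/-- The recursion satisfied by the one-site weights. -/
theorem siteWeight_succ (hq : 0 < q ∧ q < 1) (s c : ℝ) (j : ℕ) :
    siteWeight q s c (j + 1) * (1 - q ^ (j + 1)) = siteWeight q s c j * (c * (1 - s ^ 2 * q ^ j)) := by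
  rw [siteWeight_eq, siteWeight_eq]
  linear_combination (qPochhammerInf q c / qPochhammerInf q (c * s ^ 2)) * c ^ (j + 1) *
    qBinomialCoeff_succ hq (s ^ 2) j

theorem isProbabilityMeasure_siteMeasure (hq : 0 < q ∧ q < 1) (hs : -1 < s ∧ s < 0)
    (hc : 0 ≤ c ∧ c < 1) : IsProbabilityMeasure (siteMeasure q s c) := by
  constructor
  have h := hasSum_siteWeight hq hs hc
  rw [siteMeasure, Measure.sum_apply _ MeasurableSet.univ]
  simp only [Measure.smul_apply, measure_univ, smul_eq_mul, mul_one]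
  rw [← ENNReal.ofReal_tsum_of_nonneg (siteWeight_nonneg hq hs hc) h.summable, h.tsum_eq,
    ENNReal.ofReal_one]

theorem integral_siteMeasure (hq : 0 < q ∧ q < 1) (hs : -1 < s ∧ s < 0) (hc : 0 ≤ c ∧ c < 1)
    {g : ℕ → ℝ} {C : ℝ} (hg : ∀ n, |g n| ≤ C) :
    ∫ n, g n ∂siteMeasure q s c = ∑' n, siteWeight q s c n * g n := by
  have := isProbabilityMeasure_siteMeasure hq hs hc
  have hint : Integrable g (siteMeasure q s c) :=
    Integrable.of_bound (by fun_prop) C (Eventually.of_forall hg)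
  rw [siteMeasure] at hint ⊢
  rw [integral_sum_measure hint]
  simp [ENNReal.toReal_ofReal (siteWeight_nonneg hq hs hc _)]

/-- Adding a particle under the one-site measure. -/
theorem integral_siteMeasure_succ (hq : 0 < q ∧ q < 1) (hs : -1 < s ∧ s < 0) (hc : 0 ≤ c ∧ c < 1)
    {g : ℕ → ℝ} {C : ℝ} (hg : ∀ n, |g n| ≤ C) :
    ∫ n, (1 - q ^ n) * g n ∂siteMeasure q s c =
      ∫ n, c * (1 - s ^ 2 * q ^ n) * g (n + 1) ∂siteMeasure q s c := by
  have hC : 0 ≤ C := (abs_nonneg _).trans (hg 0)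
  have hp : ∀ n, 0 ≤ q ^ n ∧ q ^ n ≤ 1 := fun n => ⟨(pow_pos hq.1 n).le, pow_le_one₀ hq.1.le hq.2.le⟩
  have hs2 := sq_lt_one_of_mem hs
  have b1 : ∀ n, |(1 - q ^ n) * g n| ≤ 1 * C := fun n => by
    rw [abs_mul, abs_of_nonneg (by linarith [(hp n).2])]
    exact mul_le_mul (by linarith [(hp n).1]) (hg n) (abs_nonneg _) zero_le_one
  have b2 : ∀ n, |c * (1 - s ^ 2 * q ^ n) * g (n + 1)| ≤ 1 * C := fun n => by
    have h1 : s ^ 2 * q ^ n ≤ 1 := mul_le_one₀ hs2.le (hp n).1 (hp n).2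
    have h2 : 0 ≤ s ^ 2 * q ^ n := mul_nonneg (sq_nonneg s) (hp n).1
    rw [abs_mul, abs_of_nonneg (mul_nonneg hc.1 (by linarith))]
    refine mul_le_mul (mul_le_one₀ hc.2.le (by linarith) (by linarith)) (hg _) (abs_nonneg _)
      zero_le_one
  rw [integral_siteMeasure hq hs hc b1, integral_siteMeasure hq hs hc b2]
  have hsum : Summable fun n => siteWeight q s c n * ((1 - q ^ n) * g n) := by
    refine Summable.of_norm_bounded ((hasSum_siteWeight hq hs hc).summable.mul_right (1 * C))
      fun n => ?_
    rw [norm_mul, Real.norm_of_nonneg (siteWeight_nonneg hq hs hc n)]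
    exact mul_le_mul_of_nonneg_left (b1 n) (siteWeight_nonneg hq hs hc n)
  -- The empty site contributes nothing because `1 - q ^ 0 = 0`, so the sum can be shifted by one
  -- particle.
  rw [hsum.tsum_eq_zero_add]
  simp only [pow_zero, sub_self, zero_mul, mul_zero, zero_add]
  refine tsum_congr fun n => ?_
  linear_combination g (n + 1) * siteWeight_succ hq s c n

end SiteMeasure

/-! ### Observables, cylinder spaces, truncated generators and weighted influence -/

/-- Bounded continuous observables of the configuration. -/
abbrev Obs : Type := BoundedContinuousFunction Config ℝ

/-- Add a particle at `j`. -/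
def addParticle (j : ℤ) (η : Config) : Config := Function.update η j (η j + 1)

theorem continuous_addParticle (j : ℤ) : Continuous (addParticle j) :=
  continuous_id.update j (by fun_prop)

theorem continuous_moveParticle (i j : ℤ) : Continuous fun η : Config => moveParticle η i j := by
  refine continuous_pi fun k => ?_
  unfold moveParticle
  split_ifs
  · exact (continuous_of_discreteTopology (f := fun n : ℕ => n - 1)).comp (continuous_apply k)
  · fun_prop
  · fun_prop

/-- The sites `-M, …, M`. -/
def box (M : ℕ) : Finset ℤ := Finset.Icc (-(M : ℤ)) M

theorem mem_box {M : ℕ} {i : ℤ} : i ∈ box M ↔ i.natAbs ≤ M := by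
  simp only [box, Finset.mem_Icc]; omega

theorem box_mono {m M : ℕ} (h : m ≤ M) : box m ⊆ box M := fun _ hi =>
  mem_box.2 ((mem_box.1 hi).trans h)

/-- The pairs of sites in `box M`. -/
def boxPairs (M : ℕ) : Finset (ℤ × ℤ) := box M ×ˢ box M

theorem boxPairs_mono {m M : ℕ} (h : m ≤ M) : boxPairs m ⊆ boxPairs M :=
  Finset.product_subset_product (box_mono h) (box_mono h)

/-- Observables that depend on the sites of `box M` only. -/
def cyl (M : ℕ) : Submodule ℝ Obs where
  carrier := {f | DependsOn f (box M : Set ℤ)}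
  add_mem' := fun hf hg x y h => by simp [hf h, hg h]
  zero_mem' := fun x y _ => rfl
  smul_mem' := fun c f hf x y h => by simp [hf h]

theorem cyl_mono {m M : ℕ} (h : m ≤ M) : cyl m ≤ cyl M := fun _ hf _ _ hxy =>
  hf fun i hi => hxy i (box_mono h hi)

theorem isClosed_cyl (M : ℕ) : IsClosed (cyl M : Set Obs) := by
  have : (cyl M : Set Obs) = ⋂ (x : Config) (y : Config) (_ : ∀ i ∈ (box M : Set ℤ), x i = y i),
      {f : Obs | f x = f y} := by
    ext f
    simp only [Set.mem_iInter, Set.mem_ofPred_eq]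
    exact Iff.rfl
  rw [this]
  refine isClosed_iInter fun x => isClosed_iInter fun y => isClosed_iInter fun _ =>
    isClosed_eq ?_ ?_
  · exact (BoundedContinuousFunction.evalCLM ℝ x).continuous
  · exact (BoundedContinuousFunction.evalCLM ℝ y).continuous

/-- The discrete derivative `f ↦ f(· + 1_j) - f`. -/
def incr (j : ℤ) : Obs →L[ℝ] Obs :=
  BoundedContinuousFunction.compContinuousCLM ℝ ℝ ⟨addParticle j, continuous_addParticle j⟩ -
    ContinuousLinearMap.id ℝ Obs

theorem incr_apply (j : ℤ) (f : Obs) (η : Config) : incr j f η = f (addParticle j η) - f η := rfl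

theorem incr_eq_zero {M : ℕ} {f : Obs} (hf : f ∈ cyl M) {j : ℤ} (hj : j ∉ box M) :
    incr j f = 0 := by
  ext η
  rw [incr_apply, BoundedContinuousFunction.coe_zero, Pi.zero_apply, sub_eq_zero]
  refine hf fun i hi => ?_
  have : i ≠ j := fun h => hj (h ▸ hi)
  simp [addParticle, this]

/-- The number of sites strictly between `p.1` and `p.2`. -/
def gap (p : ℤ × ℤ) : ℕ := (p.2 - p.1 - 1).toNat

/-- An exponentially decaying bound for jump rates. -/
def rateBound (a ρ : ℝ) (p : ℤ × ℤ) : ℝ := if p.1 < p.2 then a * ρ ^ (2 * gap p) else 0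

/-- The decay of the interaction that remains after comparing the weights of the sites involved. -/
def interaction (a ρ : ℝ) (p : ℤ × ℤ) : ℝ :=
  if p.1 < p.2 then a * ((gap p + 2 : ℝ) * ρ ^ gap p) * ρ⁻¹ else 0

/-- The exponential weight of a site. -/
def weight (ρ : ℝ) (l : ℤ) : ℝ := (ρ⁻¹) ^ l.natAbs

/-- Exponentially decaying bounded local jump rates for systems of particles jumping to the
right. -/
structure IsJumpRate (r : ℤ × ℤ → Obs) (a ρ : ℝ) : Prop where
  a_nonneg : 0 ≤ a
  rho_pos : 0 < ρ
  rho_lt_one : ρ < 1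
  nonneg : ∀ p η, 0 ≤ r p η
  le : ∀ p η, r p η ≤ rateBound a ρ p
  dependsOn : ∀ p, DependsOn (r p) (Set.Icc p.1 p.2)
  vacant : ∀ p η, η p.1 = 0 → r p η = 0

/-- The generator of the system in which only the jumps in `F` are allowed. -/
def genOn (r : ℤ × ℤ → Obs) (F : Finset (ℤ × ℤ)) : Obs →L[ℝ] Obs :=
  ∑ p ∈ F, (ContinuousLinearMap.mul ℝ Obs (r p)).comp
    (BoundedContinuousFunction.compContinuousCLM ℝ ℝ
      ⟨fun η => moveParticle η p.1 p.2, continuous_moveParticle p.1 p.2⟩ -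
        ContinuousLinearMap.id ℝ Obs)

theorem genOn_apply (r : ℤ × ℤ → Obs) (F : Finset (ℤ × ℤ)) (f : Obs) (η : Config) :
    genOn r F f η = ∑ p ∈ F, r p η * (f (moveParticle η p.1 p.2) - f η) := by
  simp only [genOn, sum_apply, BoundedContinuousFunction.coe_sum,
    Finset.sum_apply]
  rfl

/-- The weighted total influence of the sites in `box M`. -/
def influence (ρ : ℝ) (M : ℕ) (f : Obs) : ℝ := ∑ l ∈ box M, weight ρ l * ‖incr l f‖

/-! ### Summing the exponentially decaying interaction -/

section Sums

variable {a ρ : ℝ}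

theorem weight_pos (hρ : 0 < ρ) (l : ℤ) : 0 < weight ρ l := pow_pos (inv_pos.2 hρ) _

theorem interaction_nonneg (ha : 0 ≤ a) (hρ : 0 < ρ) (p : ℤ × ℤ) : 0 ≤ interaction a ρ p := by
  unfold interaction
  split_ifs
  · positivity
  · exact le_rfl

theorem rateBound_nonneg (ha : 0 ≤ a) (hρ : 0 < ρ) (p : ℤ × ℤ) : 0 ≤ rateBound a ρ p := by
  unfold rateBound
  split_ifs
  · positivity
  · exact le_rfl

/-- One factor `ρ ^ gap` of the squared decay is traded for `ρ ^ M` times the weight of `l`. The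
harmless factor `(gap + 2) / ρ ≥ 1` is inserted so that the same `interaction` serves here and in
the commutator estimate. -/
theorem rateBound_le_of_near (ha : 0 ≤ a) (hρ : 0 < ρ) (hρ1 : ρ < 1) {p : ℤ × ℤ} {M : ℕ} {l : ℤ}
    (hl : p.1 < p.2 → M ≤ l.natAbs + gap p) :
    rateBound a ρ p ≤ ρ ^ M * (interaction a ρ p * weight ρ l) := by
  unfold rateBound interaction weight
  split_ifs with h
  · have h1 : ρ ^ gap p ≤ ρ ^ M * (ρ⁻¹) ^ l.natAbs := by
      rw [inv_pow, ← div_eq_mul_inv, le_div_iff₀ (by positivity), ← pow_add]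
      exact pow_le_pow_of_le_one hρ.le hρ1.le (by have := hl h; omega)
    have h2 : 1 ≤ (gap p + 2 : ℝ) * ρ⁻¹ := by
      have : 1 ≤ ρ⁻¹ := (one_le_inv₀ hρ).2 hρ1.le
      have h0 : (0 : ℝ) ≤ gap p := Nat.cast_nonneg _
      nlinarith
    calc a * ρ ^ (2 * gap p) = a * ρ ^ gap p * 1 * ρ ^ gap p := by rw [two_mul, pow_add]; ring
      _ ≤ a * ρ ^ gap p * ((gap p + 2 : ℝ) * ρ⁻¹) * (ρ ^ M * (ρ⁻¹) ^ l.natAbs) := by gcongr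
      _ = _ := by ring
  · simp

/-- The interval has `gap + 2` sites, and the weights of two of them differ by at most `ρ⁻¹ ^ (gap +
1)`; this is where the shape of `interaction` comes from. -/
theorem sum_weight_mul_rateBound_le (ha : 0 ≤ a) (hρ : 0 < ρ) (hρ1 : ρ < 1) {p : ℤ × ℤ} {l : ℤ}
    (hl : l ∈ Finset.Icc p.1 p.2) :
    (∑ j ∈ Finset.Icc p.1 p.2, weight ρ j) * rateBound a ρ p ≤ interaction a ρ p * weight ρ l := by
  unfold rateBound interaction
  split_ifs with h
  · have h1 : ∀ j ∈ Finset.Icc p.1 p.2, weight ρ j ≤ (ρ⁻¹) ^ (gap p + 1) * weight ρ l := by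
      intro j hj
      rw [weight, weight, ← pow_add]
      refine pow_le_pow_right₀ ((one_le_inv₀ hρ).2 hρ1.le) ?_
      simp only [gap, Finset.mem_Icc] at *
      omega
    have h2 : ((Finset.Icc p.1 p.2).card : ℝ) = gap p + 2 := by
      have : (Finset.Icc p.1 p.2).card = gap p + 2 := by rw [Int.card_Icc, gap]; omega
      rw [this]; push_cast; ring
    calc _ ≤ (Finset.Icc p.1 p.2).card • ((ρ⁻¹) ^ (gap p + 1) * weight ρ l) *
          (a * ρ ^ (2 * gap p)) := by
          gcongr
          exact Finset.sum_le_card_nsmul _ _ _ h1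
      _ = a * ((gap p + 2 : ℝ) * (ρ ^ gap p * ((ρ⁻¹) ^ gap p * ρ ^ gap p))) * ρ⁻¹ * weight ρ l := by
          rw [nsmul_eq_mul, h2, two_mul, pow_add, pow_succ]; ring
      _ = _ := by
          rw [inv_pow, inv_mul_cancel₀ (pow_ne_zero _ hρ.ne'), mul_one]
  · simp

/-- The total interaction strength of a site. -/
def totalInteraction (a ρ : ℝ) : ℝ := ∑' n : ℕ, a * ((n + 2 : ℝ) * ρ ^ n) * ρ⁻¹

theorem summable_interaction (hρ : 0 < ρ) (hρ1 : ρ < 1) :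
    Summable fun n : ℕ => a * ((n + 2 : ℝ) * ρ ^ n) * ρ⁻¹ := by
  have h1 : Summable fun n : ℕ => (n : ℝ) ^ 1 * ρ ^ n :=
    summable_pow_mul_geometric_of_norm_lt_one 1 (by rwa [Real.norm_of_nonneg hρ.le])
  have h2 := (summable_geometric_of_lt_one hρ.le hρ1).mul_left 2
  refine (((h1.add h2).mul_left a).mul_right ρ⁻¹).congr fun n => ?_
  ring

theorem totalInteraction_nonneg (ha : 0 ≤ a) (hρ : 0 < ρ) : 0 ≤ totalInteraction a ρ :=
  tsum_nonneg fun n => by positivity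

theorem hasSum_interaction_fst (hρ : 0 < ρ) (hρ1 : ρ < 1) (l : ℤ) :
    HasSum (fun p : ℤ × ℤ => if p.1 = l then interaction a ρ p else 0) (totalInteraction a ρ) := by
  have hinj : Function.Injective fun n : ℕ => ((l, l + 1 + n) : ℤ × ℤ) := fun m n h => by
    simp only [Prod.mk.injEq] at h; omega
  rw [← hinj.hasSum_iff]
  · refine (summable_interaction (a := a) hρ hρ1).hasSum.congr_fun ?_
    intro n
    have h : gap (l, l + 1 + n) = n := by simp only [gap]; omega
    have h' : l < l + 1 + n := by omega
    simp [interaction, h, h']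
  · rintro ⟨i, j⟩ hp
    simp only [ite_eq_right_iff, interaction]
    intro hi h
    exact absurd ⟨(j - l - 1).toNat, by simp only [Prod.mk.injEq]; omega⟩ hp

theorem hasSum_interaction_snd (hρ : 0 < ρ) (hρ1 : ρ < 1) (l : ℤ) :
    HasSum (fun p : ℤ × ℤ => if p.2 = l then interaction a ρ p else 0) (totalInteraction a ρ) := by
  have hinj : Function.Injective fun n : ℕ => ((l - 1 - n, l) : ℤ × ℤ) := fun m n h => by
    simp only [Prod.mk.injEq] at h; omega
  rw [← hinj.hasSum_iff]
  · refine (summable_interaction (a := a) hρ hρ1).hasSum.congr_fun ?_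
    intro n
    have h : gap (l - 1 - n, l) = n := by simp only [gap]; omega
    have h' : l - 1 - n < l := by omega
    simp [interaction, h, h']
  · rintro ⟨i, j⟩ hp
    simp only [ite_eq_right_iff, interaction]
    intro hi h
    exact absurd ⟨(l - i - 1).toNat, by simp only [Prod.mk.injEq]; omega⟩ hp

/-- Each site interacts with total strength `totalInteraction a ρ` as a starting point and again as
an end point, hence the factor `2`. -/
theorem hasSum_interaction_mul (hρ : 0 < ρ) (hρ1 : ρ < 1) {u : ℤ → ℝ} {B : Finset ℤ}
    (hu : ∀ l ∉ B, u l = 0) :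
    HasSum (fun p : ℤ × ℤ => interaction a ρ p * (u p.1 + u p.2))
      (2 * totalInteraction a ρ * ∑ l ∈ B, u l) := by
  have key : ∀ (g : ℤ × ℤ → ℤ),
      (∀ l, HasSum (fun p : ℤ × ℤ => if g p = l then interaction a ρ p else 0)
        (totalInteraction a ρ)) →
      HasSum (fun p : ℤ × ℤ => interaction a ρ p * u (g p))
        (totalInteraction a ρ * ∑ l ∈ B, u l) := by
    intro g hg
    rw [Finset.mul_sum]
    refine (hasSum_sum fun l (_ : l ∈ B) => (hg l).mul_right (u l)).congr_fun fun p => ?_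
    by_cases hp : g p ∈ B
    · rw [Finset.sum_eq_single_of_mem _ hp (fun l _ hl => by simp [hl.symm])]
      simp
    · rw [hu _ hp, mul_zero, Finset.sum_eq_zero fun l hl => ?_]
      rw [if_neg (fun h => hp (by rwa [h])), zero_mul]
  have := (key _ (hasSum_interaction_fst hρ hρ1)).add (key _ (hasSum_interaction_snd hρ hρ1))
  convert! this using 1
  · ext p; ring
  · ring

end Sums

theorem influence_nonneg {ρ : ℝ} (hρ : 0 < ρ) (M : ℕ) (f : Obs) : 0 ≤ influence ρ M f :=
  Finset.sum_nonneg fun l _ => mul_nonneg (weight_pos hρ l).le (norm_nonneg _)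

theorem influence_eq_of_le (ρ : ℝ) {m M : ℕ} (h : m ≤ M) {f : Obs} (hf : f ∈ cyl m) :
    influence ρ M f = influence ρ m f := by
  refine (Finset.sum_subset (box_mono h) fun l _ hl => ?_).symm
  rw [incr_eq_zero hf hl, norm_zero, mul_zero]

/-! ### Bounds on single jumps and on the truncation error -/

section JumpEstimates

variable {r : ℤ × ℤ → Obs} {a ρ : ℝ}

theorem IsJumpRate.eq_zero_of_not_lt (hr : IsJumpRate r a ρ) {p : ℤ × ℤ} (h : ¬ p.1 < p.2)
    (η : Config) : r p η = 0 :=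
  le_antisymm ((hr.le p η).trans (by simp [rateBound, h])) (hr.nonneg p η)

theorem moveParticle_addParticle {i j : ℤ} (hij : i ≠ j) (η : Config) :
    moveParticle (addParticle i η) i j = addParticle j η := by
  funext k
  by_cases hk : k = i
  · subst hk; simp [moveParticle, addParticle, hij]
  · by_cases hk' : k = j
    · subst hk'; simp [moveParticle, addParticle, hk]
    · simp [moveParticle, addParticle, hk, hk']

theorem exists_addParticle_eq {η : Config} {i : ℤ} (h : η i ≠ 0) : ∃ ζ, addParticle i ζ = η :=
  ⟨Function.update η i (η i - 1), by
    funext k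
    by_cases hk : k = i
    · subst hk; simp [addParticle]; omega
    · simp [addParticle, hk]⟩

theorem addParticle_comm (i j : ℤ) (η : Config) :
    addParticle i (addParticle j η) = addParticle j (addParticle i η) := by
  by_cases h : i = j
  · rw [h]
  · funext k
    by_cases hk : k = i
    · subst hk; simp [addParticle, h]
    · by_cases hk' : k = j
      · subst hk'; simp [addParticle, hk]
      · simp [addParticle, hk, hk']

/-- Occupancy of `i` matters: on an empty site the truncated subtraction removes nothing, and the
two operations differ when `j = i`. -/
theorem moveParticle_addParticle_comm {i k : ℤ} (hik : i ≠ k) {η : Config} (h : η i ≠ 0) (j : ℤ) :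
    moveParticle (addParticle j η) i k = addParticle j (moveParticle η i k) := by
  obtain ⟨ζ, rfl⟩ := exists_addParticle_eq h
  rw [addParticle_comm, moveParticle_addParticle hik, moveParticle_addParticle hik,
    addParticle_comm]

/-- Take the jumping particle out: with `η = ζ + 1_i`, the jump replaces `ζ + 1_i` by `ζ + 1_j`, so
its effect is a difference of two one-particle increments at `ζ`. -/
theorem abs_sub_moveParticle_le {i j : ℤ} (hij : i ≠ j) {η : Config} (h : η i ≠ 0) (f : Obs) :
    |f (moveParticle η i j) - f η| ≤ ‖incr i f‖ + ‖incr j f‖ := by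
  obtain ⟨ζ, rfl⟩ := exists_addParticle_eq h
  rw [moveParticle_addParticle hij]
  have h1 := (incr i f).norm_coe_le_norm ζ
  have h2 := (incr j f).norm_coe_le_norm ζ
  rw [incr_apply, Real.norm_eq_abs] at h1 h2
  calc _ = |(f (addParticle j ζ) - f ζ) - (f (addParticle i ζ) - f ζ)| := by ring_nf
    _ ≤ _ := (abs_sub _ _).trans (by linarith)

theorem IsJumpRate.abs_jump_le (hr : IsJumpRate r a ρ) (p : ℤ × ℤ) (f : Obs) (η : Config) :
    |r p η * (f (moveParticle η p.1 p.2) - f η)| ≤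
      rateBound a ρ p * (‖incr p.1 f‖ + ‖incr p.2 f‖) := by
  have hb := rateBound_nonneg hr.a_nonneg hr.rho_pos p
  by_cases h0 : η p.1 = 0
  · rw [hr.vacant p η h0, zero_mul, abs_zero]; positivity
  by_cases hp : p.1 < p.2
  · rw [abs_mul, abs_of_nonneg (hr.nonneg p η)]
    exact mul_le_mul (hr.le p η) (abs_sub_moveParticle_le hp.ne h0 f) (abs_nonneg _) hb
  · rw [hr.eq_zero_of_not_lt hp, zero_mul, abs_zero]; positivity

/-- The weighted increments of an observable. -/
def wincr (ρ : ℝ) (f : Obs) (l : ℤ) : ℝ := weight ρ l * ‖incr l f‖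

theorem wincr_nonneg (hρ : 0 < ρ) (f : Obs) (l : ℤ) : 0 ≤ wincr ρ f l :=
  mul_nonneg (weight_pos hρ l).le (norm_nonneg _)

theorem hasSum_interaction_mul_wincr (hr : IsJumpRate r a ρ) {M : ℕ} {f : Obs} (hf : f ∈ cyl M) :
    HasSum (fun p : ℤ × ℤ => interaction a ρ p * (wincr ρ f p.1 + wincr ρ f p.2))
      (2 * totalInteraction a ρ * influence ρ M f) :=
  hasSum_interaction_mul hr.rho_pos hr.rho_lt_one fun l hl => by
    rw [wincr, incr_eq_zero hf hl, norm_zero, mul_zero]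

theorem IsJumpRate.abs_jump_le_interaction (hr : IsJumpRate r a ρ) (p : ℤ × ℤ) (f : Obs)
    (η : Config) : |r p η * (f (moveParticle η p.1 p.2) - f η)| ≤
      interaction a ρ p * (wincr ρ f p.1 + wincr ρ f p.2) := by
  have h : ∀ l, rateBound a ρ p ≤ interaction a ρ p * weight ρ l := fun l => by
    simpa using rateBound_le_of_near (M := 0) (l := l) hr.a_nonneg hr.rho_pos hr.rho_lt_one
      (fun _ => Nat.zero_le _)
  refine (hr.abs_jump_le p f η).trans ?_
  rw [mul_add, mul_add, wincr, wincr, ← mul_assoc, ← mul_assoc]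
  gcongr <;> exact h _

/-- An endpoint outside the box has zero increment. If the other endpoint `l` is inside, the jump
leaves the box, so `|l| + gap ≥ M` and the decay yields `ρ ^ M`. -/
theorem IsJumpRate.abs_jump_le_of_notMem (hr : IsJumpRate r a ρ) {M : ℕ} {p : ℤ × ℤ}
    (hp : p ∉ boxPairs M) {f : Obs} (hf : f ∈ cyl M) (η : Config) :
    |r p η * (f (moveParticle η p.1 p.2) - f η)| ≤
      ρ ^ M * (interaction a ρ p * (wincr ρ f p.1 + wincr ρ f p.2)) := by
  refine (hr.abs_jump_le p f η).trans ?_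
  have h : ∀ l, (l = p.1 ∨ l = p.2) → rateBound a ρ p * ‖incr l f‖ ≤
      ρ ^ M * (interaction a ρ p * wincr ρ f l) := by
    intro l hl
    by_cases hlM : l ∈ box M
    · rw [wincr, ← mul_assoc, ← mul_assoc]
      refine mul_le_mul_of_nonneg_right ?_ (norm_nonneg _)
      rw [mul_assoc]
      refine rateBound_le_of_near hr.a_nonneg hr.rho_pos hr.rho_lt_one fun hlt => ?_
      simp only [boxPairs, Finset.mem_product, mem_box] at hp hlM
      simp only [gap]
      rcases hl with rfl | rfl <;> omega
    · rw [wincr, incr_eq_zero hf hlM, norm_zero]; simp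
  have h1 := h p.1 (Or.inl rfl)
  have h2 := h p.2 (Or.inr rfl)
  rw [mul_add, mul_add, mul_add]
  exact add_le_add h1 h2

theorem norm_genOn_le (hr : IsJumpRate r a ρ) {M : ℕ} {f : Obs} (hf : f ∈ cyl M)
    (F : Finset (ℤ × ℤ)) :
    ‖genOn r F f‖ ≤ 2 * totalInteraction a ρ * influence ρ M f := by
  have hn : ∀ p : ℤ × ℤ, 0 ≤ interaction a ρ p * (wincr ρ f p.1 + wincr ρ f p.2) := fun p =>
    mul_nonneg (interaction_nonneg hr.a_nonneg hr.rho_pos p)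
      (add_nonneg (wincr_nonneg hr.rho_pos _ _) (wincr_nonneg hr.rho_pos _ _))
  have hs := hasSum_interaction_mul_wincr hr hf
  rw [BoundedContinuousFunction.norm_le (hs.nonneg hn)]
  intro η
  rw [genOn_apply, Real.norm_eq_abs]
  exact (Finset.abs_sum_le_sum_abs _ _).trans ((Finset.sum_le_sum fun p _ =>
    hr.abs_jump_le_interaction p f η).trans (sum_le_hasSum F (fun p _ => hn p) hs))

theorem abs_genOn_sub_le (hr : IsJumpRate r a ρ) {M : ℕ} {f : Obs} (hf : f ∈ cyl M)
    {F : Finset (ℤ × ℤ)} (hF : boxPairs M ⊆ F) (η : Config) :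
    |genOn r F f η - genOn r (boxPairs M) f η| ≤
      2 * totalInteraction a ρ * ρ ^ M * influence ρ M f := by
  have hn : ∀ p : ℤ × ℤ, 0 ≤ interaction a ρ p * (wincr ρ f p.1 + wincr ρ f p.2) := fun p =>
    mul_nonneg (interaction_nonneg hr.a_nonneg hr.rho_pos p)
      (add_nonneg (wincr_nonneg hr.rho_pos _ _) (wincr_nonneg hr.rho_pos _ _))
  have hs := hasSum_interaction_mul_wincr hr hf
  rw [genOn_apply, genOn_apply, ← Finset.sum_sdiff hF, add_sub_cancel_right]
  calc _ ≤ ∑ p ∈ F \ boxPairs M, ρ ^ M * (interaction a ρ p * (wincr ρ f p.1 + wincr ρ f p.2)) :=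
        (Finset.abs_sum_le_sum_abs _ _).trans (Finset.sum_le_sum fun p hp =>
          hr.abs_jump_le_of_notMem (Finset.mem_sdiff.1 hp).2 hf η)
    _ ≤ ρ ^ M * (2 * totalInteraction a ρ * influence ρ M f) := by
        rw [← Finset.mul_sum]
        exact mul_le_mul_of_nonneg_left (sum_le_hasSum _ (fun p _ => hn p) hs)
          (pow_nonneg hr.rho_pos.le M)
    _ = _ := by ring

theorem norm_genOn_sub_le (hr : IsJumpRate r a ρ) {M : ℕ} {f : Obs} (hf : f ∈ cyl M)
    {F : Finset (ℤ × ℤ)} (hF : boxPairs M ⊆ F) :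
    ‖genOn r F f - genOn r (boxPairs M) f‖ ≤
      2 * totalInteraction a ρ * ρ ^ M * influence ρ M f := by
  rw [BoundedContinuousFunction.norm_le]
  · exact fun η => abs_genOn_sub_le hr hf hF η
  · have := totalInteraction_nonneg hr.a_nonneg hr.rho_pos
    have := influence_nonneg hr.rho_pos M f
    have := hr.rho_pos
    positivity

/-- The full generator, as a sum over all pairs. -/
def genAll (r : ℤ × ℤ → Obs) (f : Obs) (η : Config) : ℝ :=
  ∑' p : ℤ × ℤ, r p η * (f (moveParticle η p.1 p.2) - f η)

theorem hasSum_genAll (hr : IsJumpRate r a ρ) {M : ℕ} {f : Obs} (hf : f ∈ cyl M) (η : Config) :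
    HasSum (fun p : ℤ × ℤ => r p η * (f (moveParticle η p.1 p.2) - f η)) (genAll r f η) :=
  (Summable.of_norm_bounded (hasSum_interaction_mul_wincr hr hf).summable
    (fun p => hr.abs_jump_le_interaction p f η)).hasSum

theorem abs_genAll_sub_le (hr : IsJumpRate r a ρ) {M : ℕ} {f : Obs} (hf : f ∈ cyl M)
    (η : Config) : |genAll r f η - genOn r (boxPairs M) f η| ≤
      2 * totalInteraction a ρ * ρ ^ M * influence ρ M f := by
  refine le_of_tendsto (((hasSum_genAll hr hf η).sub_const _).abs)
    ((eventually_ge_atTop (boxPairs M)).mono fun F hF => ?_)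
  rw [← genOn_apply]
  exact abs_genOn_sub_le hr hf hF η

theorem genOn_boxPairs_mem_cyl (hr : IsJumpRate r a ρ) {M : ℕ} {f : Obs} (hf : f ∈ cyl M) :
    genOn r (boxPairs M) f ∈ cyl M := by
  intro x y h
  rw [genOn_apply, genOn_apply]
  refine Finset.sum_congr rfl fun p hp => ?_
  have hp' := Finset.mem_product.1 hp
  have h1 : r p x = r p y := hr.dependsOn p fun i hi => h i (by
    have h3 := mem_box.1 hp'.1
    have h4 := mem_box.1 hp'.2
    have := hi.1
    have := hi.2
    exact Finset.mem_coe.2 (mem_box.2 (by omega)))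
  have h2 : f (moveParticle x p.1 p.2) = f (moveParticle y p.1 p.2) := hf fun i hi => by
    simp only [moveParticle, h i hi]
  rw [h1, h2, hf h]

end JumpEstimates

/-! ### Exponentials of bounded operators and seminorm growth -/

section ExpSeminorm

variable {E : Type*} [NormedAddCommGroup E] [NormedSpace ℝ E]

/-- The operator semigroup generated by a bounded operator. -/
def expSemigroup (L : E →L[ℝ] E) (t : ℝ) : E →L[ℝ] E := NormedSpace.exp (t • L)

theorem expSemigroup_zero (L : E →L[ℝ] E) : expSemigroup L 0 = 1 := by
  simp [expSemigroup]

variable [CompleteSpace E]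

theorem hasSum_exp_apply (A : E →L[ℝ] E) (f : E) :
    HasSum (fun n : ℕ => ((n.factorial : ℝ)⁻¹) • (A ^ n) f) (NormedSpace.exp A f) :=
  (NormedSpace.exp_series_hasSum_exp' (𝕂 := ℝ) A).mapL (ContinuousLinearMap.apply ℝ E f)

theorem seminorm_exp_le (p : Seminorm ℝ E) (hp : Continuous p) {A : E →L[ℝ] E} {κ : ℝ} (hκ : 0 ≤ κ)
    (h : ∀ f, p (A f) ≤ κ * p f) (f : E) : p (NormedSpace.exp A f) ≤ Real.exp κ * p f := by
  have hpow : ∀ n : ℕ, p ((A ^ n) f) ≤ κ ^ n * p f := by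
    intro n
    induction n with
    | zero => simp
    | succ n ih =>
      rw [pow_succ', pow_succ', mul_assoc]
      change p (A ((A ^ n) f)) ≤ _
      exact (h _).trans (mul_le_mul_of_nonneg_left ih hκ)
  refine le_of_tendsto' ((hp.tendsto _).comp (hasSum_exp_apply A f).tendsto_sum_nat) fun n => ?_
  calc p (∑ i ∈ Finset.range n, ((i.factorial : ℝ)⁻¹) • (A ^ i) f)
      ≤ ∑ i ∈ Finset.range n, p (((i.factorial : ℝ)⁻¹) • (A ^ i) f) :=
        Finset.le_sum_of_subadditive p (map_zero p).le (map_add_le_add p) _ _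
    _ ≤ ∑ i ∈ Finset.range n, κ ^ i / i.factorial * p f := by
        refine Finset.sum_le_sum fun i _ => ?_
        rw [map_smul_eq_mul, norm_inv, Real.norm_natCast, div_eq_inv_mul, mul_assoc]
        exact mul_le_mul_of_nonneg_left (hpow i) (by positivity)
    _ ≤ _ := by
        rw [← Finset.sum_mul]
        exact mul_le_mul_of_nonneg_right (Real.sum_le_exp_of_nonneg hκ n) (apply_nonneg p f)

/-- Expanding in powers of the Euler step `1 + ε L` rather than of `L` avoids growth governed by
`‖L‖`, which depends on the box: a bound `1 + ε C` for the step yields `exp (C t)`, whatever `ε` is.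
-/
theorem exp_smul_eq (L : E →L[ℝ] E) {ε : ℝ} (hε : 0 < ε) (t : ℝ) :
    NormedSpace.exp (t • L) =
      Real.exp (-(t / ε)) • NormedSpace.exp ((t / ε) • (1 + ε • L)) := by
  let : NormedAlgebra ℚ (E →L[ℝ] E) := NormedAlgebra.restrictScalars ℚ ℝ (E →L[ℝ] E)
  have h1 : (t / ε) • (1 + ε • L) = (t / ε) • (1 : E →L[ℝ] E) + t • L := by
    rw [smul_add, smul_smul, div_mul_cancel₀ _ hε.ne']
  have h2 : NormedSpace.exp ((t / ε) • (1 : E →L[ℝ] E)) = Real.exp (t / ε) • 1 := by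
    rw [← Algebra.algebraMap_eq_smul_one, ← Algebra.algebraMap_eq_smul_one, Real.exp_eq_exp_ℝ,
      NormedSpace.algebraMap_exp_comm]
  rw [h1, NormedSpace.exp_add_of_commute ((Commute.one_left _).smul_left _), h2, smul_mul_assoc,
    one_mul, smul_smul, ← Real.exp_add, neg_add_cancel, Real.exp_zero, one_smul]

theorem expSemigroup_add (L : E →L[ℝ] E) (t u : ℝ) :
    expSemigroup L (t + u) = expSemigroup L t * expSemigroup L u := by
  let : NormedAlgebra ℚ (E →L[ℝ] E) := NormedAlgebra.restrictScalars ℚ ℝ (E →L[ℝ] E)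
  rw [expSemigroup, add_smul, NormedSpace.exp_add_of_commute]
  · rfl
  · exact ((Commute.refl _).smul_left _).smul_right _

theorem hasDerivAt_expSemigroup (L : E →L[ℝ] E) (f : E) (t : ℝ) :
    HasDerivAt (fun u => expSemigroup L u f) (expSemigroup L t (L f)) t :=
  (ContinuousLinearMap.apply ℝ E f).hasFDerivAt.comp_hasDerivAt t (hasDerivAt_exp_smul_const L t)

theorem hasDerivAt_expSemigroup' (L : E →L[ℝ] E) (f : E) (t : ℝ) :
    HasDerivAt (fun u => expSemigroup L u f) (L (expSemigroup L t f)) t :=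
  (ContinuousLinearMap.apply ℝ E f).hasFDerivAt.comp_hasDerivAt t (hasDerivAt_exp_smul_const' L t)

/-- If the Euler step `1 + ε L` expands a seminorm by at most `1 + ε C`, then the semigroup
generated by `L` expands it by at most `exp (C t)`. -/
theorem seminorm_semigroup_le (p : Seminorm ℝ E) (hp : Continuous p) {L : E →L[ℝ] E} {ε C : ℝ}
    (hε : 0 < ε) (hC : 0 ≤ C) (h : ∀ f, p (f + ε • L f) ≤ (1 + ε * C) * p f) {t : ℝ} (ht : 0 ≤ t)
    (f : E) : p (expSemigroup L t f) ≤ Real.exp (C * t) * p f := by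
  have hA : ∀ f, p (((t / ε) • (1 + ε • L)) f) ≤ (t / ε * (1 + ε * C)) * p f := fun f => by
    have : ((t / ε) • (1 + ε • L)) f = (t / ε) • (f + ε • L f) := rfl
    rw [this, map_smul_eq_mul, Real.norm_of_nonneg (by positivity), mul_assoc]
    exact mul_le_mul_of_nonneg_left (h f) (by positivity)
  have hexp := seminorm_exp_le p hp (by positivity) hA f
  rw [expSemigroup, exp_smul_eq L hε t]
  change p (Real.exp (-(t / ε)) • _) ≤ _
  rw [map_smul_eq_mul, Real.norm_of_nonneg (Real.exp_pos _).le]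
  calc _ ≤ Real.exp (-(t / ε)) * (Real.exp (t / ε * (1 + ε * C)) * p f) :=
        mul_le_mul_of_nonneg_left hexp (Real.exp_pos _).le
    _ = _ := by
        rw [← mul_assoc, ← Real.exp_add]
        congr 2
        field_simp
        ring

theorem exp_apply_mem {S : Submodule ℝ E} (hS : IsClosed (S : Set E)) {A : E →L[ℝ] E}
    (h : ∀ f ∈ S, A f ∈ S) {f : E} (hf : f ∈ S) : NormedSpace.exp A f ∈ S := by
  have hpow : ∀ n : ℕ, (A ^ n) f ∈ S := by
    intro n
    induction n with
    | zero => simpa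
    | succ n ih =>
      rw [pow_succ']
      exact h _ ih
  exact hS.mem_of_tendsto (hasSum_exp_apply A f).tendsto_sum_nat
    (Eventually.of_forall fun n => S.sum_mem fun i _ => S.smul_mem _ (hpow i))

end ExpSeminorm

/-! ### Contraction and influence growth for the finite systems -/

section Contraction

variable {r : ℤ × ℤ → Obs} {a ρ : ℝ}

/-- The influence as a seminorm. -/
def influenceSeminorm {ρ : ℝ} (hρ : 0 < ρ) (M : ℕ) : Seminorm ℝ Obs :=
  Seminorm.of (influence ρ M)
    (fun f g => by
      rw [influence, influence, influence, ← Finset.sum_add_distrib]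
      refine Finset.sum_le_sum fun l _ => ?_
      rw [← mul_add, map_add]
      exact mul_le_mul_of_nonneg_left (norm_add_le _ _) (weight_pos hρ l).le)
    (fun c f => by
      rw [influence, influence, Finset.mul_sum]
      refine Finset.sum_congr rfl fun l _ => ?_
      rw [map_smul, norm_smul]; ring)

theorem continuous_influence (ρ : ℝ) (M : ℕ) : Continuous (influence ρ M) :=
  continuous_finsetSum _ fun l _ => ((incr l).continuous.norm).const_mul _

/-- For small `ε` the Euler step is a convex combination of `f` and its values after the allowed
jumps. -/
theorem norm_euler_le (hr : IsJumpRate r a ρ) {F : Finset (ℤ × ℤ)} {ε : ℝ} (hε : 0 ≤ ε)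
    (hF : ε * ∑ p ∈ F, rateBound a ρ p ≤ 1) (f : Obs) : ‖f + ε • genOn r F f‖ ≤ ‖f‖ := by
  rw [BoundedContinuousFunction.norm_le (norm_nonneg _)]
  intro η
  have h1 : (f + ε • genOn r F f) η = (1 - ε * ∑ p ∈ F, r p η) * f η +
      ε * ∑ p ∈ F, r p η * f (moveParticle η p.1 p.2) := by
    simp only [BoundedContinuousFunction.coe_add, BoundedContinuousFunction.coe_smul, Pi.add_apply,
      genOn_apply, smul_eq_mul, mul_sub, Finset.sum_sub_distrib, ← Finset.sum_mul]
    ring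
  have h2 : ε * ∑ p ∈ F, r p η ≤ 1 :=
    (mul_le_mul_of_nonneg_left (Finset.sum_le_sum fun p _ => hr.le p η) hε).trans hF
  rw [h1, Real.norm_eq_abs]
  calc _ ≤ (1 - ε * ∑ p ∈ F, r p η) * ‖f‖ + ε * ∑ p ∈ F, r p η * ‖f‖ := by
        refine (abs_add_le _ _).trans (add_le_add ?_ ?_)
        · rw [abs_mul, abs_of_nonneg (by linarith)]
          exact mul_le_mul_of_nonneg_left (f.norm_coe_le_norm η) (by linarith)
        · rw [abs_mul, abs_of_nonneg hε]
          refine mul_le_mul_of_nonneg_left ((Finset.abs_sum_le_sum_abs _ _).trans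
            (Finset.sum_le_sum fun p _ => ?_)) hε
          rw [abs_mul, abs_of_nonneg (hr.nonneg p η)]
          exact mul_le_mul_of_nonneg_left (f.norm_coe_le_norm _) (hr.nonneg p η)
    _ = ‖f‖ := by rw [← Finset.sum_mul]; ring

/-- The commutator of the generator with a discrete derivative is local. -/
theorem norm_incr_genOn_sub_le (hr : IsJumpRate r a ρ) (F : Finset (ℤ × ℤ)) (f : Obs) (j : ℤ) :
    ‖incr j (genOn r F f) - genOn r F (incr j f)‖ ≤ ∑ p ∈ F,
      if j ∈ Finset.Icc p.1 p.2 then rateBound a ρ p * (‖incr p.1 f‖ + ‖incr p.2 f‖) else 0 := by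
  have hb : ∀ p, 0 ≤ rateBound a ρ p := rateBound_nonneg hr.a_nonneg hr.rho_pos
  rw [BoundedContinuousFunction.norm_le (Finset.sum_nonneg fun p _ => by
    have := hb p
    split_ifs <;> positivity)]
  intro η
  rw [BoundedContinuousFunction.coe_sub, Pi.sub_apply, incr_apply, genOn_apply, genOn_apply,
    genOn_apply, ← Finset.sum_sub_distrib, ← Finset.sum_sub_distrib, Real.norm_eq_abs]
  refine (Finset.abs_sum_le_sum_abs _ _).trans (Finset.sum_le_sum fun p _ => ?_)
  set η' := addParticle j η with hη'
  -- Adding a particle at `j` commutes with an allowed jump, so the commutator retains only the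
  -- change of the rate. This change vanishes unless `j` lies between the endpoints.
  have hdef : (r p η' * (f (moveParticle η' p.1 p.2) - f η') -
      r p η * (f (moveParticle η p.1 p.2) - f η) -
      r p η * (incr j f (moveParticle η p.1 p.2) - incr j f η)) =
      (r p η' - r p η) * (f (moveParticle η' p.1 p.2) - f η') := by
    by_cases hp : p.1 < p.2
    · by_cases h0 : η p.1 = 0
      · rw [hr.vacant p η h0]; ring
      · rw [incr_apply, incr_apply, ← moveParticle_addParticle_comm hp.ne h0, ← hη']; ring
    · rw [hr.eq_zero_of_not_lt hp, hr.eq_zero_of_not_lt hp]; ring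
  rw [hdef]
  split_ifs with hj
  · have hle : |r p η' - r p η| ≤ rateBound a ρ p := by
      rw [abs_le]
      constructor <;> linarith [hr.nonneg p η, hr.nonneg p η', hr.le p η, hr.le p η']
    by_cases hp : p.1 < p.2
    · by_cases h0 : η' p.1 = 0
      · have h1 : η p.1 = 0 := by
          by_contra h
          have : η p.1 ≤ η' p.1 := by
            rw [hη', addParticle]
            by_cases hpj : p.1 = j
            · rw [hpj]; simp
            · simp [hpj]
          omega
        rw [hr.vacant p η h1, hr.vacant p η' h0, sub_self, zero_mul, abs_zero]
        have := hb p
        positivity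
      · rw [abs_mul]
        exact mul_le_mul hle (abs_sub_moveParticle_le hp.ne h0 f) (abs_nonneg _) (hb p)
    · rw [hr.eq_zero_of_not_lt hp, hr.eq_zero_of_not_lt hp, sub_self, zero_mul, abs_zero]
      have := hb p
      positivity
  · have : r p η' = r p η := hr.dependsOn p fun i hi => by
      have hij : i ≠ j := fun h => hj (by rw [← h]; exact Finset.mem_Icc.2 hi)
      simp [hη', addParticle, hij]
    rw [this, sub_self, zero_mul, abs_zero]

/-- The Euler step contracts each increment, up to the commutator. Summing the commutators against
the weights and exchanging the sums costs `totalInteraction` once per endpoint, uniformly in `M`. -/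
theorem influence_euler_le (hr : IsJumpRate r a ρ) {M : ℕ} {ε : ℝ} (hε : 0 ≤ ε)
    (hF : ε * ∑ p ∈ boxPairs M, rateBound a ρ p ≤ 1) (f : Obs) :
    influence ρ M (f + ε • genOn r (boxPairs M) f) ≤
      (1 + ε * (2 * totalInteraction a ρ)) * influence ρ M f := by
  have hb : ∀ p, 0 ≤ rateBound a ρ p := rateBound_nonneg hr.a_nonneg hr.rho_pos
  set F := boxPairs M with hFdef
  have h1 : ∀ j, ‖incr j (f + ε • genOn r F f)‖ ≤ ‖incr j f‖ + ε * ∑ p ∈ F,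
      if j ∈ Finset.Icc p.1 p.2 then rateBound a ρ p * (‖incr p.1 f‖ + ‖incr p.2 f‖) else 0 := by
    intro j
    have : incr j (f + ε • genOn r F f) = (incr j f + ε • genOn r F (incr j f)) +
        ε • (incr j (genOn r F f) - genOn r F (incr j f)) := by
      rw [map_add, map_smul, smul_sub]; abel
    rw [this]
    refine (norm_add_le _ _).trans (add_le_add (norm_euler_le hr hε hF _) ?_)
    rw [norm_smul, Real.norm_of_nonneg hε]
    exact mul_le_mul_of_nonneg_left (norm_incr_genOn_sub_le hr F f j) hε
  -- Here `f` is not assumed to be a cylinder observable of `box M`, so its increments are cut off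
  -- outside the box to apply the summation lemma.
  set u : ℤ → ℝ := fun l => if l ∈ box M then wincr ρ f l else 0 with hu
  have hu0 : ∀ l, 0 ≤ u l := fun l => by
    rw [hu]
    have := wincr_nonneg hr.rho_pos f l
    dsimp only
    split_ifs <;> simp [this]
  have hs := hasSum_interaction_mul (a := a) (B := box M) hr.rho_pos hr.rho_lt_one (u := u)
    (fun l hl => if_neg hl)
  have hub : ∑ l ∈ box M, u l = influence ρ M f :=
    Finset.sum_congr rfl fun l hl => if_pos hl
  have h2 : ∑ j ∈ box M, weight ρ j * ∑ p ∈ F,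
      (if j ∈ Finset.Icc p.1 p.2 then rateBound a ρ p * (‖incr p.1 f‖ + ‖incr p.2 f‖) else 0) ≤
      2 * totalInteraction a ρ * influence ρ M f := by
    rw [← hub]
    refine le_trans ?_ (sum_le_hasSum F (fun p _ => mul_nonneg
      (interaction_nonneg hr.a_nonneg hr.rho_pos p) (add_nonneg (hu0 _) (hu0 _))) hs)
    simp only [Finset.mul_sum]
    rw [Finset.sum_comm]
    refine Finset.sum_le_sum fun p hp => ?_
    have hpM := Finset.mem_product.1 hp
    have e1 : u p.1 = wincr ρ f p.1 := if_pos hpM.1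
    have e2 : u p.2 = wincr ρ f p.2 := if_pos hpM.2
    by_cases hlt : p.1 < p.2
    · have h3 : ∑ j ∈ box M, weight ρ j * (if j ∈ Finset.Icc p.1 p.2 then
          rateBound a ρ p * (‖incr p.1 f‖ + ‖incr p.2 f‖) else 0) ≤
          (∑ j ∈ Finset.Icc p.1 p.2, weight ρ j) *
            (rateBound a ρ p * (‖incr p.1 f‖ + ‖incr p.2 f‖)) := by
        simp only [mul_ite, mul_zero]
        rw [← Finset.sum_filter, ← Finset.sum_mul]
        have := hb p
        refine mul_le_mul_of_nonneg_right (Finset.sum_le_sum_of_subset_of_nonneg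
          (fun j hj => (Finset.mem_filter.1 hj).2)
          fun j _ _ => (weight_pos hr.rho_pos j).le) (by positivity)
      refine h3.trans ?_
      rw [e1, e2, wincr, wincr, mul_add, mul_add, mul_add, ← mul_assoc, ← mul_assoc, ← mul_assoc,
        ← mul_assoc]
      exact add_le_add
        (mul_le_mul_of_nonneg_right (sum_weight_mul_rateBound_le hr.a_nonneg hr.rho_pos
          hr.rho_lt_one (Finset.mem_Icc.2 ⟨le_rfl, hlt.le⟩)) (norm_nonneg _))
        (mul_le_mul_of_nonneg_right (sum_weight_mul_rateBound_le hr.a_nonneg hr.rho_pos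
          hr.rho_lt_one (Finset.mem_Icc.2 ⟨hlt.le, le_rfl⟩)) (norm_nonneg _))
    · rw [Finset.sum_eq_zero fun j _ => ?_]
      · exact mul_nonneg (interaction_nonneg hr.a_nonneg hr.rho_pos p)
          (add_nonneg (hu0 _) (hu0 _))
      · simp [rateBound, hlt]
  calc influence ρ M (f + ε • genOn r F f)
      ≤ ∑ j ∈ box M, weight ρ j * (‖incr j f‖ + ε * ∑ p ∈ F,
        if j ∈ Finset.Icc p.1 p.2 then rateBound a ρ p * (‖incr p.1 f‖ + ‖incr p.2 f‖) else 0) :=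
        Finset.sum_le_sum fun j _ => mul_le_mul_of_nonneg_left (h1 j) (weight_pos hr.rho_pos j).le
    _ = influence ρ M f + ε * ∑ j ∈ box M, weight ρ j * ∑ p ∈ F,
        (if j ∈ Finset.Icc p.1 p.2 then rateBound a ρ p * (‖incr p.1 f‖ + ‖incr p.2 f‖) else 0) := by
        rw [influence, Finset.mul_sum, ← Finset.sum_add_distrib]
        exact Finset.sum_congr rfl fun j _ => by ring
    _ ≤ influence ρ M f + ε * (2 * totalInteraction a ρ * influence ρ M f) := by gcongr
    _ = _ := by ring

/-- The semigroup of the system in which only jumps inside `box M` are allowed. -/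
def boxSemigroup (r : ℤ × ℤ → Obs) (M : ℕ) (t : ℝ) : Obs →L[ℝ] Obs :=
  expSemigroup (genOn r (boxPairs M)) t

/-- A step size for which the Euler steps are averages. -/
def eulerStep (a ρ : ℝ) (F : Finset (ℤ × ℤ)) : ℝ := (1 + ∑ p ∈ F, rateBound a ρ p)⁻¹

theorem eulerStep_pos (ha : 0 ≤ a) (hρ : 0 < ρ) (F : Finset (ℤ × ℤ)) : 0 < eulerStep a ρ F := by
  have : 0 ≤ ∑ p ∈ F, rateBound a ρ p := Finset.sum_nonneg fun p _ => rateBound_nonneg ha hρ p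
  unfold eulerStep
  positivity

theorem eulerStep_mul_le (ha : 0 ≤ a) (hρ : 0 < ρ) (F : Finset (ℤ × ℤ)) :
    eulerStep a ρ F * ∑ p ∈ F, rateBound a ρ p ≤ 1 := by
  have : 0 ≤ ∑ p ∈ F, rateBound a ρ p := Finset.sum_nonneg fun p _ => rateBound_nonneg ha hρ p
  rw [eulerStep, inv_mul_le_iff₀ (by positivity)]
  linarith

theorem norm_boxSemigroup_le (hr : IsJumpRate r a ρ) (M : ℕ) {t : ℝ} (ht : 0 ≤ t) (f : Obs) :
    ‖boxSemigroup r M t f‖ ≤ ‖f‖ := by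
  have := seminorm_semigroup_le (normSeminorm ℝ Obs) continuous_norm
    (L := genOn r (boxPairs M)) (eulerStep_pos hr.a_nonneg hr.rho_pos (boxPairs M)) le_rfl
    (fun f => by
      simpa using norm_euler_le hr (eulerStep_pos hr.a_nonneg hr.rho_pos _).le
        (eulerStep_mul_le hr.a_nonneg hr.rho_pos (boxPairs M)) f) ht f
  simpa [boxSemigroup] using this

theorem influence_boxSemigroup_le (hr : IsJumpRate r a ρ) (M : ℕ) {t : ℝ} (ht : 0 ≤ t) (f : Obs) :
    influence ρ M (boxSemigroup r M t f) ≤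
      Real.exp (2 * totalInteraction a ρ * t) * influence ρ M f :=
  seminorm_semigroup_le (influenceSeminorm hr.rho_pos M) (continuous_influence ρ M)
    (L := genOn r (boxPairs M)) (eulerStep_pos hr.a_nonneg hr.rho_pos (boxPairs M))
    (mul_nonneg zero_le_two (totalInteraction_nonneg hr.a_nonneg hr.rho_pos))
    (fun f => influence_euler_le hr (eulerStep_pos hr.a_nonneg hr.rho_pos _).le
      (eulerStep_mul_le hr.a_nonneg hr.rho_pos (boxPairs M)) f) ht f

theorem boxSemigroup_mem_cyl (hr : IsJumpRate r a ρ) {M : ℕ} (t : ℝ) {f : Obs} (hf : f ∈ cyl M) :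
    boxSemigroup r M t f ∈ cyl M :=
  exp_apply_mem (isClosed_cyl M)
    (fun _ hg => (cyl M).smul_mem t (genOn_boxPairs_mem_cyl hr hg)) hf

theorem boxSemigroup_zero (r : ℤ × ℤ → Obs) (M : ℕ) : boxSemigroup r M 0 = 1 :=
  expSemigroup_zero _

theorem boxSemigroup_add (r : ℤ × ℤ → Obs) (M : ℕ) (t u : ℝ) :
    boxSemigroup r M (t + u) = boxSemigroup r M t * boxSemigroup r M u :=
  expSemigroup_add _ _ _

theorem hasDerivAt_boxSemigroup (r : ℤ × ℤ → Obs) (M : ℕ) (f : Obs) (t : ℝ) :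
    HasDerivAt (fun u => boxSemigroup r M u f)
      (boxSemigroup r M t (genOn r (boxPairs M) f)) t :=
  hasDerivAt_expSemigroup _ _ _

theorem hasDerivAt_boxSemigroup' (r : ℤ × ℤ → Obs) (M : ℕ) (f : Obs) (t : ℝ) :
    HasDerivAt (fun u => boxSemigroup r M u f)
      (genOn r (boxPairs M) (boxSemigroup r M t f)) t :=
  hasDerivAt_expSemigroup' _ _ _

end Contraction

/-! ### Duhamel comparison and the limit semigroup -/

section Comparison

variable {r : ℤ × ℤ → Obs} {a ρ : ℝ}

/-- Product rule for a moving functional applied to a moving vector. -/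
theorem hasDerivWithinAt_functional_apply {E : Type*} [NormedAddCommGroup E] [NormedSpace ℝ E]
    {S : Set ℝ} {φ : ℝ → E →ₗ[ℝ] ℝ} (hφ : ∀ s ∈ S, ∀ g, |φ s g| ≤ ‖g‖) {g : ℝ → E} {g' : E}
    {s ψ ψ' : ℝ} (hg : HasDerivWithinAt g g' S s)
    (hψ : HasDerivWithinAt (fun u => φ u (g s)) ψ S s)
    (hψ' : HasDerivWithinAt (fun u => φ u g') ψ' S s) :
    HasDerivWithinAt (fun u => φ u (g u)) (ψ + φ s g') S s := by
  rw [hasDerivWithinAt_iff_isLittleO] at hg hψ ⊢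
  -- The increment splits into three parts: the linearisation error of `g`, controlled by
  -- contractivity; the variation of `φ` at `g'`; and the differentiability of `φ` at the fixed
  -- vector `g s`. No operator-norm continuity of `φ` is needed.
  have h1 : (fun u => φ u (g u - g s - (u - s) • g')) =o[𝓝[S] s] fun u => u - s := by
    refine Asymptotics.IsBigO.trans_isLittleO ?_ hg
    refine Asymptotics.IsBigO.of_bound 1 ?_
    filter_upwards [self_mem_nhdsWithin] with u hu
    rw [one_mul]
    exact hφ u hu _
  have h2 : (fun u => (u - s) * (φ u g' - φ s g')) =o[𝓝[S] s] fun u => u - s := by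
    have h3 : (fun u => φ u g' - φ s g') =o[𝓝[S] s] fun _ => (1 : ℝ) := by
      rw [Asymptotics.isLittleO_one_iff]
      simpa using hψ'.continuousWithinAt.tendsto.sub_const (φ s g')
    simpa using (Asymptotics.isBigO_refl (fun u => u - s) (𝓝[S] s)).mul_isLittleO h3
  refine ((h1.add h2).add hψ).congr_left fun u => ?_
  simp only [map_sub, map_smul, smul_eq_mul]
  ring

/-- Functionals that approximately solve the forward equation of the system in `box M` are close to
its semigroup. -/
theorem abs_functional_sub_boxSemigroup_le (hr : IsJumpRate r a ρ) {M : ℕ} {T : ℝ} (hT : 0 ≤ T)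
    (φ : ℝ → Obs →ₗ[ℝ] ℝ) (ψ : ℝ → Obs → ℝ) {C : ℝ} (hC : 0 ≤ C)
    (hφ : ∀ s, 0 ≤ s → ∀ g, |φ s g| ≤ ‖g‖)
    (hd : ∀ g ∈ cyl M, ∀ s, 0 ≤ s → HasDerivWithinAt (fun u => φ u g) (ψ s g) (Set.Ici 0) s)
    (hψ : ∀ g ∈ cyl M, ∀ s, 0 ≤ s →
      |ψ s g - φ s (genOn r (boxPairs M) g)| ≤ C * influence ρ M g)
    {f : Obs} (hf : f ∈ cyl M) :
    |φ T f - φ 0 (boxSemigroup r M T f)| ≤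
      C * (Real.exp (2 * totalInteraction a ρ * T) * influence ρ M f) * T := by
  set L := genOn r (boxPairs M)
  -- Duhamel interpolation: `φ s` applied to the box evolution over the remaining time `T - s`
  -- passes from `φ 0 (boxSemigroup r M T f)` to `φ T f`, and its derivative is the generator
  -- discrepancy.
  set g : ℝ → Obs := fun s => boxSemigroup r M (T - s) f with hg
  have hgc : ∀ s, g s ∈ cyl M := fun s => boxSemigroup_mem_cyl hr _ hf
  have hgd : ∀ s, HasDerivAt g (-(L (g s))) s := fun s => by
    have h := (hasDerivAt_boxSemigroup' r M f (T - s)).scomp s ((hasDerivAt_id s).const_sub T)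
    simpa using! h
  have hS : (0 : ℝ) ≤ 2 * totalInteraction a ρ :=
    mul_nonneg zero_le_two (totalInteraction_nonneg hr.a_nonneg hr.rho_pos)
  have key := norm_image_sub_le_of_norm_deriv_le_segment' (a := 0) (b := T)
    (f := fun u => φ u (g u)) (f' := fun s => ψ s (g s) + φ s (-(L (g s))))
    (C := C * (Real.exp (2 * totalInteraction a ρ * T) * influence ρ M f))
    (fun s hs => by
      have hsub : Set.Icc 0 T ⊆ Set.Ici (0 : ℝ) := fun x hx => hx.1
      exact hasDerivWithinAt_functional_apply (fun u hu => hφ u hu.1) (hgd s).hasDerivWithinAt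
        ((hd _ (hgc s) s hs.1).mono hsub)
        ((hd _ ((cyl M).neg_mem (genOn_boxPairs_mem_cyl hr (hgc s))) s hs.1).mono hsub))
    (fun s hs => by
      rw [map_neg, ← sub_eq_add_neg, Real.norm_eq_abs]
      refine (hψ _ (hgc s) s hs.1).trans (mul_le_mul_of_nonneg_left ?_ hC)
      refine (influence_boxSemigroup_le hr M (by linarith [hs.2]) f).trans ?_
      have := influence_nonneg hr.rho_pos M f
      gcongr
      linarith [hs.1])
    T ⟨hT, le_rfl⟩
  simpa [hg, boxSemigroup_zero] using key

/-- The constant in the rate of convergence of the finite systems. -/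
def errorConst (a ρ t : ℝ) : ℝ :=
  2 * totalInteraction a ρ * Real.exp (2 * totalInteraction a ρ * t) * t

theorem errorConst_nonneg (hr : IsJumpRate r a ρ) {t : ℝ} (ht : 0 ≤ t) : 0 ≤ errorConst a ρ t := by
  have := totalInteraction_nonneg hr.a_nonneg hr.rho_pos
  unfold errorConst
  positivity

/-- A version of the comparison in which the approximation error is that of the truncation. -/
theorem abs_functional_sub_boxSemigroup_le_errorConst (hr : IsJumpRate r a ρ) {M : ℕ} {T : ℝ}
    (hT : 0 ≤ T) (φ : ℝ → Obs →ₗ[ℝ] ℝ) (ψ : ℝ → Obs → ℝ)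
    (hφ : ∀ s, 0 ≤ s → ∀ g, |φ s g| ≤ ‖g‖)
    (hd : ∀ g ∈ cyl M, ∀ s, 0 ≤ s → HasDerivWithinAt (fun u => φ u g) (ψ s g) (Set.Ici 0) s)
    (hψ : ∀ g ∈ cyl M, ∀ s, 0 ≤ s → |ψ s g - φ s (genOn r (boxPairs M) g)| ≤
      2 * totalInteraction a ρ * ρ ^ M * influence ρ M g)
    {f : Obs} (hf : f ∈ cyl M) :
    |φ T f - φ 0 (boxSemigroup r M T f)| ≤ errorConst a ρ T * ρ ^ M * influence ρ M f := by
  have hS := totalInteraction_nonneg hr.a_nonneg hr.rho_pos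
  have hρ := hr.rho_pos
  refine (abs_functional_sub_boxSemigroup_le hr hT φ ψ (by positivity) hφ hd hψ hf).trans
    (le_of_eq ?_)
  rw [errorConst]; ring

/-- Evaluation of the semigroup in a box at a configuration. -/
def boxFunctional (r : ℤ × ℤ → Obs) (M : ℕ) (η : Config) (t : ℝ) : Obs →ₗ[ℝ] ℝ :=
  ((BoundedContinuousFunction.evalCLM ℝ η).comp (boxSemigroup r M t)).toLinearMap

theorem boxFunctional_apply (r : ℤ × ℤ → Obs) (M : ℕ) (η : Config) (t : ℝ) (f : Obs) :
    boxFunctional r M η t f = boxSemigroup r M t f η := rfl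

theorem abs_boxFunctional_le (hr : IsJumpRate r a ρ) (M : ℕ) (η : Config) {t : ℝ} (ht : 0 ≤ t)
    (f : Obs) : |boxFunctional r M η t f| ≤ ‖f‖ :=
  ((boxSemigroup r M t f).norm_coe_le_norm η).trans (norm_boxSemigroup_le hr M ht f)

theorem hasDerivAt_boxFunctional (r : ℤ × ℤ → Obs) (M : ℕ) (η : Config) (f : Obs) (t : ℝ) :
    HasDerivAt (fun u => boxFunctional r M η u f)
      (boxFunctional r M η t (genOn r (boxPairs M) f)) t :=
  (BoundedContinuousFunction.evalCLM ℝ η : Obs →L[ℝ] ℝ).hasFDerivAt.comp_hasDerivAt t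
    (hasDerivAt_boxSemigroup r M f t)

/-- The larger system, evaluated at `η`, is itself an approximate solution of the smaller system's
forward equation, so the comparison applies to it. -/
theorem norm_boxSemigroup_sub_le (hr : IsJumpRate r a ρ) {M M' : ℕ} (hM : M ≤ M') {t : ℝ}
    (ht : 0 ≤ t) {f : Obs} (hf : f ∈ cyl M) :
    ‖boxSemigroup r M' t f - boxSemigroup r M t f‖ ≤
      errorConst a ρ t * ρ ^ M * influence ρ M f := by
  have h0 := errorConst_nonneg hr ht
  have h1 := influence_nonneg hr.rho_pos M f
  have h2 := hr.rho_pos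
  rw [BoundedContinuousFunction.norm_le (by positivity)]
  intro η
  have := abs_functional_sub_boxSemigroup_le_errorConst hr ht (boxFunctional r M' η)
    (fun s g => boxFunctional r M' η s (genOn r (boxPairs M') g))
    (fun s hs g => abs_boxFunctional_le hr M' η hs g)
    (fun g _ s _ => (hasDerivAt_boxFunctional r M' η g s).hasDerivWithinAt)
    (fun g hg s hs => by
      rw [← map_sub]
      exact (abs_boxFunctional_le hr M' η hs _).trans
        (norm_genOn_sub_le hr hg (boxPairs_mono hM))) hf
  simpa [boxFunctional_apply, boxSemigroup_zero] using! this

/-- The semigroup of the infinite system on cylinder observables. -/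
def limitSemigroup (r : ℤ × ℤ → Obs) (t : ℝ) (f : Obs) : Obs :=
  limUnder atTop fun M => boxSemigroup r M t f

theorem tendsto_rho_pow (hr : IsJumpRate r a ρ) (A B : ℝ) :
    Tendsto (fun M : ℕ => A * ρ ^ M * B) atTop (𝓝 0) := by
  simpa using ((tendsto_pow_atTop_nhds_zero_of_lt_one hr.rho_pos.le hr.rho_lt_one).const_mul
    A).mul_const B

theorem tendsto_limitSemigroup (hr : IsJumpRate r a ρ) {m : ℕ} {f : Obs} (hf : f ∈ cyl m) {t : ℝ}
    (ht : 0 ≤ t) : Tendsto (fun M => boxSemigroup r M t f) atTop (𝓝 (limitSemigroup r t f)) := by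
  refine CauchySeq.tendsto_limUnder (Metric.cauchySeq_iff'.2 fun ε hε => ?_)
  obtain ⟨N, hN, hmN⟩ := (((tendsto_rho_pow hr (errorConst a ρ t) (influence ρ m f)).eventually
    (gt_mem_nhds hε)).and (eventually_ge_atTop m)).exists
  refine ⟨N, fun n hn => ?_⟩
  rw [dist_eq_norm]
  refine (norm_boxSemigroup_sub_le hr hn ht (cyl_mono hmN hf)).trans_lt ?_
  rwa [influence_eq_of_le ρ hmN hf]

theorem norm_limitSemigroup_sub_le (hr : IsJumpRate r a ρ) {M : ℕ} {t : ℝ} (ht : 0 ≤ t) {f : Obs}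
    (hf : f ∈ cyl M) : ‖limitSemigroup r t f - boxSemigroup r M t f‖ ≤
      errorConst a ρ t * ρ ^ M * influence ρ M f :=
  le_of_tendsto ((tendsto_limitSemigroup hr hf ht).sub_const _).norm
    ((eventually_ge_atTop M).mono fun _ hM => norm_boxSemigroup_sub_le hr hM ht hf)

/-- Exact solutions of the forward equation on cylinder observables are given by the limit
semigroup. -/
theorem functional_eq_limitSemigroup (hr : IsJumpRate r a ρ) {T : ℝ}
    (hT : 0 ≤ T) (φ : ℝ → Obs →ₗ[ℝ] ℝ) (ψ : ℝ → Obs → ℝ)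
    (hφ : ∀ s, 0 ≤ s → ∀ g, |φ s g| ≤ ‖g‖)
    (hd : ∀ M, ∀ g ∈ cyl M, ∀ s, 0 ≤ s →
      HasDerivWithinAt (fun u => φ u g) (ψ s g) (Set.Ici 0) s)
    (hψ : ∀ M, ∀ g ∈ cyl M, ∀ s, 0 ≤ s → |ψ s g - φ s (genOn r (boxPairs M) g)| ≤
      2 * totalInteraction a ρ * ρ ^ M * influence ρ M g)
    {m : ℕ} {f : Obs} (hf : f ∈ cyl m) : φ T f = φ 0 (limitSemigroup r T f) := by
  have h1 : Tendsto (fun M => φ 0 (boxSemigroup r M T f)) atTop (𝓝 (φ T f)) := by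
    rw [tendsto_iff_norm_sub_tendsto_zero]
    refine squeeze_zero' (Eventually.of_forall fun M => norm_nonneg _) ?_
      (tendsto_rho_pow hr (errorConst a ρ T) (influence ρ m f))
    filter_upwards [eventually_ge_atTop m] with M hM
    rw [norm_sub_rev, Real.norm_eq_abs, ← influence_eq_of_le ρ hM hf]
    exact abs_functional_sub_boxSemigroup_le_errorConst hr hT φ ψ hφ (hd M) (hψ M) (cyl_mono hM hf)
  have h2 : Tendsto (fun M => φ 0 (boxSemigroup r M T f)) atTop (𝓝 (φ 0 (limitSemigroup r T f))) :=
    (((φ 0).mkContinuous 1 fun g => by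
      simpa using hφ 0 le_rfl g).continuous.tendsto _).comp (tendsto_limitSemigroup hr hf hT)
  exact tendsto_nhds_unique h1 h2

end Comparison

/-! ### Transition measures of the finite systems -/

section Mixture

theorem exists_mixture {Ω ι : Type*} [MeasurableSpace Ω] [TopologicalSpace Ω]
    [OpensMeasurableSpace Ω] {w : ι → ℝ} (hw : ∀ i, 0 ≤ w i) (hs : HasSum w 1) (μ : ι → Measure Ω)
    (hμ : ∀ i, IsProbabilityMeasure (μ i)) :
    ∃ ν : Measure Ω, IsProbabilityMeasure ν ∧ ∀ f : BoundedContinuousFunction Ω ℝ,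
      HasSum (fun i => w i * ∫ ω, f ω ∂μ i) (∫ ω, f ω ∂ν) := by
  have hprob : IsProbabilityMeasure (Measure.sum fun i => ENNReal.ofReal (w i) • μ i) := by
    constructor
    rw [Measure.sum_apply _ MeasurableSet.univ]
    simp only [Measure.smul_apply, measure_univ, smul_eq_mul, mul_one]
    rw [← ENNReal.ofReal_tsum_of_nonneg hw hs.summable, hs.tsum_eq, ENNReal.ofReal_one]
  refine ⟨_, hprob, fun f => ?_⟩
  have h := hasSum_integral_measure (f.integrable (Measure.sum fun i => ENNReal.ofReal (w i) • μ i))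
  simpa [integral_smul_measure, ENNReal.toReal_ofReal (hw _)] using h

end Mixture

/-- Uniformisation: the semigroup is a Poisson mixture, with mean `t / ε`, of powers of the Euler
step. -/
theorem hasSum_expSemigroup_apply {E : Type*} [NormedAddCommGroup E] [NormedSpace ℝ E]
    [CompleteSpace E] (L : E →L[ℝ] E) {ε : ℝ} (hε : 0 < ε) (t : ℝ) (f : E) :
    HasSum (fun n : ℕ => (Real.exp (-(t / ε)) * ((t / ε) ^ n / n.factorial)) •
      ((1 + ε • L) ^ n) f) (expSemigroup L t f) := by
  have h := (hasSum_exp_apply ((t / ε) • (1 + ε • L)) f).const_smul (Real.exp (-(t / ε)))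
  have h' : expSemigroup L t f =
      Real.exp (-(t / ε)) • NormedSpace.exp ((t / ε) • (1 + ε • L)) f := by
    rw [expSemigroup, exp_smul_eq _ hε]
    rfl
  rw [h']
  refine h.congr_fun fun n => ?_
  rw [smul_pow]
  change _ = Real.exp (-(t / ε)) • ((n.factorial : ℝ)⁻¹ • (t / ε) ^ n • ((1 + ε • L) ^ n) f)
  rw [smul_smul, smul_smul]
  congr 1
  ring

section BoxMeasure

variable {r : ℤ × ℤ → Obs} {a ρ : ℝ}

/-- One Euler step is a discrete-time Markov chain: `none` stands for staying put, `some p` for the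
jump `p`. Building its laws as explicit mixtures gives genuine measures on a noncompact space, where
a positive functional on bounded continuous functions need not be one. -/
theorem exists_measure_euler_pow (hr : IsJumpRate r a ρ) {F : Finset (ℤ × ℤ)} {ε : ℝ} (hε : 0 ≤ ε)
    (hF : ε * ∑ p ∈ F, rateBound a ρ p ≤ 1) (n : ℕ) (η : Config) :
    ∃ μ : Measure Config, IsProbabilityMeasure μ ∧
      ∀ f : Obs, ((1 + ε • genOn r F) ^ n) f η = ∫ ζ, f ζ ∂μ := by
  induction n generalizing η with
  | zero => exact ⟨Measure.dirac η, inferInstance, fun f => by simp⟩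
  | succ n ih =>
    choose μ hμ hint using ih
    have h2 : ε * ∑ p ∈ F, r p η ≤ 1 :=
      (mul_le_mul_of_nonneg_left (Finset.sum_le_sum fun p _ => hr.le p η) hε).trans hF
    obtain ⟨ν, hν, hsum⟩ := exists_mixture (ι := Option F)
      (w := fun o => o.elim (1 - ε * ∑ p ∈ F, r p η) fun p => ε * r p η)
      (by
        rintro (_ | p)
        · simpa using h2
        · exact mul_nonneg hε (hr.nonneg p η))
      (by
        have h := hasSum_fintype
          (fun o : Option F => o.elim (1 - ε * ∑ p ∈ F, r p η) fun p => ε * r p η)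
        rw [Fintype.sum_option] at h
        simp only [Option.elim] at h
        rwa [← Finset.mul_sum, Finset.sum_coe_sort F fun p => r p η, sub_add_cancel] at h)
      (fun o => o.elim (μ η) fun p => μ (moveParticle η p.1.1 p.1.2))
      (by
        rintro (_ | p)
        · exact hμ _
        · exact hμ _)
    refine ⟨ν, hν, fun f => ?_⟩
    have h := (hsum f).unique (hasSum_fintype _)
    rw [h, Fintype.sum_option]
    simp only [Option.elim, ← hint]
    rw [Finset.sum_coe_sort F
      fun p => ε * r p η * (((1 + ε • genOn r F) ^ n) f (moveParticle η p.1 p.2)), pow_succ']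
    change ((((1 + ε • genOn r F) ^ n) f) + ε • genOn r F (((1 + ε • genOn r F) ^ n) f)) η = _
    simp only [BoundedContinuousFunction.coe_add, BoundedContinuousFunction.coe_smul, Pi.add_apply,
      genOn_apply, smul_eq_mul, mul_sub, Finset.sum_sub_distrib, ← Finset.sum_mul, mul_assoc,
      ← Finset.mul_sum]
    ring

theorem exists_boxMeasure (hr : IsJumpRate r a ρ) (M : ℕ) {t : ℝ} (ht : 0 ≤ t) (η : Config) :
    ∃ μ : Measure Config, IsProbabilityMeasure μ ∧
      ∀ f : Obs, boxSemigroup r M t f η = ∫ ζ, f ζ ∂μ := by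
  set F := boxPairs M with hF
  set ε := eulerStep a ρ F
  have hε : 0 < ε := eulerStep_pos hr.a_nonneg hr.rho_pos F
  choose μ hμ hint using fun n => exists_measure_euler_pow hr hε.le
    (eulerStep_mul_le hr.a_nonneg hr.rho_pos F) n η
  set x := t / ε with hx
  have hx0 : 0 ≤ x := by positivity
  obtain ⟨ν, hν, hsum⟩ := exists_mixture (w := fun n : ℕ => Real.exp (-x) * (x ^ n / n.factorial))
    (fun n => by positivity)
    (by
      have h := (NormedSpace.expSeries_div_hasSum_exp (𝔸 := ℝ) x).mul_left (Real.exp (-x))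
      rwa [← Real.exp_eq_exp_ℝ, ← Real.exp_add, neg_add_cancel, Real.exp_zero] at h) μ hμ
  refine ⟨ν, hν, fun f => ?_⟩
  refine HasSum.unique ?_ (hsum f)
  have h := (hasSum_expSemigroup_apply (genOn r F) hε t f).mapL
    (BoundedContinuousFunction.evalCLM ℝ η : Obs →L[ℝ] ℝ)
  refine h.congr_fun fun n => ?_
  rw [← hint]
  rfl

end BoxMeasure

/-! ### Tightness and the limiting transition measures -/

section Tightness

variable {r : ℤ × ℤ → Obs} {a ρ : ℝ}

/-- The number of particles at `i`, truncated at `n`. -/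
def truncatedCount (i : ℤ) (n : ℕ) : Obs :=
  BoundedContinuousFunction.ofNormedAddCommGroup (fun η : Config => ((min (η i) n : ℕ) : ℝ))
    ((continuous_of_discreteTopology (f := fun k : ℕ => ((min k n : ℕ) : ℝ))).comp
      (continuous_apply i)) n fun η => by
        rw [Real.norm_natCast]; exact_mod_cast min_le_right _ _

theorem truncatedCount_apply (i : ℤ) (n : ℕ) (η : Config) :
    truncatedCount i n η = ((min (η i) n : ℕ) : ℝ) := rfl

theorem truncatedCount_mem_cyl (i : ℤ) (n : ℕ) : truncatedCount i n ∈ cyl i.natAbs :=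
  fun x y h => by
    rw [truncatedCount_apply, truncatedCount_apply, h i (Finset.mem_coe.2 (mem_box.2 le_rfl))]

theorem norm_incr_truncatedCount_le (i j : ℤ) (n : ℕ) :
    ‖incr j (truncatedCount i n)‖ ≤ if j = i then 1 else 0 := by
  rw [BoundedContinuousFunction.norm_le (by split_ifs <;> simp)]
  intro η
  rw [incr_apply, truncatedCount_apply, truncatedCount_apply, addParticle]
  split_ifs with h
  · subst h
    rw [Function.update_self, Real.norm_eq_abs, abs_le]
    have h1 : min (η j) n ≤ min (η j + 1) n := by omega
    have h2 : min (η j + 1) n ≤ min (η j) n + 1 := by omega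
    have h1' : ((min (η j) n : ℕ) : ℝ) ≤ (min (η j + 1) n : ℕ) := by exact_mod_cast h1
    have h2' : ((min (η j + 1) n : ℕ) : ℝ) ≤ (min (η j) n : ℕ) + 1 := by exact_mod_cast h2
    constructor <;> linarith
  · rw [Function.update_of_ne (Ne.symm h)]; simp

/-- The bound does not see the truncation level `n`, which is what makes the later moment bound
uniform in `n`. -/
theorem influence_truncatedCount_le (hρ : 0 < ρ) (i : ℤ) (n : ℕ) :
    influence ρ i.natAbs (truncatedCount i n) ≤ weight ρ i := by
  calc _ ≤ ∑ l ∈ box i.natAbs, weight ρ l * (if l = i then 1 else 0) :=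
        Finset.sum_le_sum fun l _ => mul_le_mul_of_nonneg_left (norm_incr_truncatedCount_le i l n)
          (weight_pos hρ l).le
    _ = weight ρ i := by simp [mem_box]

theorem norm_boxSemigroup_sub_self_le (hr : IsJumpRate r a ρ) (M : ℕ) {m : ℕ} {f : Obs}
    (hf : f ∈ cyl m) {t u : ℝ} (ht : 0 ≤ t) (htu : t ≤ u) :
    ‖boxSemigroup r M u f - boxSemigroup r M t f‖ ≤
      2 * totalInteraction a ρ * influence ρ m f * (u - t) := by
  refine norm_image_sub_le_of_norm_deriv_le_segment'
    (fun s _ => (hasDerivAt_boxSemigroup r M f s).hasDerivWithinAt) (fun s hs => ?_) u ⟨htu, le_rfl⟩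
  exact (norm_boxSemigroup_le hr M (ht.trans hs.1) _).trans (norm_genOn_le hr hf _)

/-- Markov's inequality for the truncated count, whose mean grows at most linearly in time at a
speed independent of both `M` and `n`. -/
theorem measure_count_ge_le (hr : IsJumpRate r a ρ) (M : ℕ) {t : ℝ} (ht : 0 ≤ t) (η : Config)
    {μ : Measure Config} [IsProbabilityMeasure μ]
    (hμ : ∀ f : Obs, boxSemigroup r M t f η = ∫ ζ, f ζ ∂μ) (i : ℤ) {n : ℕ} (hn : 0 < n) :
    μ {ζ | n ≤ ζ i} ≤
      ENNReal.ofReal ((η i + 2 * totalInteraction a ρ * weight ρ i * t) / n) := by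
  set f := truncatedCount i n
  have hS := totalInteraction_nonneg hr.a_nonneg hr.rho_pos
  have h1 : ∫ ζ, f ζ ∂μ ≤ η i + 2 * totalInteraction a ρ * weight ρ i * t := by
    rw [← hμ]
    have h := ((boxSemigroup r M t f - boxSemigroup r M 0 f).norm_coe_le_norm η).trans
      (norm_boxSemigroup_sub_self_le hr M (truncatedCount_mem_cyl i n) le_rfl ht)
    rw [boxSemigroup_zero, sub_zero] at h
    have h' := (le_abs_self _).trans h
    have h3 : f η ≤ η i := by
      rw [truncatedCount_apply]; exact_mod_cast min_le_left _ _
    have h4 : 2 * totalInteraction a ρ * influence ρ i.natAbs f * t ≤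
        2 * totalInteraction a ρ * weight ρ i * t := by
      gcongr
      exact influence_truncatedCount_le hr.rho_pos i n
    have h5 : boxSemigroup r M t f η - f η ≤
        2 * totalInteraction a ρ * influence ρ i.natAbs f * t := h'
    linarith
  have h2 := mul_meas_ge_le_integral_of_nonneg (μ := μ) (f := f)
    (Eventually.of_forall fun ζ => by rw [truncatedCount_apply]; exact Nat.cast_nonneg _)
    (f.integrable μ) n
  have hset : {ζ : Config | (n : ℝ) ≤ f ζ} = {ζ | n ≤ ζ i} := by
    ext ζ
    rw [Set.mem_ofPred_eq, Set.mem_ofPred_eq, truncatedCount_apply, Nat.cast_le]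
    omega
  rw [hset] at h2
  rw [← ENNReal.ofReal_toReal (measure_ne_top μ {ζ | n ≤ ζ i})]
  refine ENNReal.ofReal_le_ofReal ?_
  rw [le_div_iff₀ (by positivity), mul_comm]
  exact h2.trans h1

/-- Bounding the occupation of every site gives a product of finite sets, which is compact; the
bounds are chosen so that the exceptional probabilities sum to less than `ε` over `ℤ`. -/
theorem isTightMeasureSet_of_count {S : Set (Measure Config)} (A : ℤ → ℝ)
    (h : ∀ μ ∈ S, ∀ i, ∀ n : ℕ, 0 < n → μ {ζ : Config | n ≤ ζ i} ≤ ENNReal.ofReal (A i / n)) :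
    IsTightMeasureSet S := by
  rw [isTightMeasureSet_iff_exists_isCompact_measure_compl_le]
  intro ε hε
  obtain ⟨ε', hε', hsum⟩ := ENNReal.exists_pos_sum_of_countable' hε.ne' ℤ
  have hn : ∀ i, ∃ n : ℕ, 0 < n ∧ ENNReal.ofReal (A i / n) ≤ ε' i := by
    intro i
    have h1 : Tendsto (fun n : ℕ => ENNReal.ofReal (A i / n)) atTop (𝓝 (ENNReal.ofReal 0)) :=
      (ENNReal.continuous_ofReal.tendsto 0).comp (tendsto_const_div_atTop_nhds_zero_nat (A i))
    rw [ENNReal.ofReal_zero] at h1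
    exact ((eventually_gt_atTop 0).and ((h1.eventually (gt_mem_nhds (hε' i))).mono
      fun n hn => hn.le)).exists
  choose n hn0 hn using hn
  refine ⟨Set.univ.pi fun i => Set.Iio (n i),
    isCompact_univ_pi fun i => (Set.finite_Iio (n i)).isCompact, fun μ hμ => ?_⟩
  have hsub : (Set.univ.pi fun i => Set.Iio (n i) : Set Config)ᶜ ⊆ ⋃ i, {ζ : Config | n i ≤ ζ i} := by
    intro ζ hζ
    simpa using hζ
  calc _ ≤ μ (⋃ i, {ζ : Config | n i ≤ ζ i}) := measure_mono hsub
    _ ≤ ∑' i, μ {ζ : Config | n i ≤ ζ i} := measure_iUnion_le _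
    _ ≤ ∑' i, ε' i := ENNReal.tsum_le_tsum fun i => (h μ hμ i (n i) (hn0 i)).trans (hn i)
    _ ≤ ε := hsum.le

theorem exists_limitMeasure (hr : IsJumpRate r a ρ) {t : ℝ} (ht : 0 ≤ t) (η : Config) :
    ∃ ν : Measure Config, IsProbabilityMeasure ν ∧
      ∀ m, ∀ f ∈ cyl m, ∫ ζ, f ζ ∂ν = limitSemigroup r t f η := by
  choose μ hμ hint using fun M => exists_boxMeasure hr M ht η
  let μ' : ℕ → ProbabilityMeasure Config := fun M => ⟨μ M, hμ M⟩
  have htight : IsTightMeasureSet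
      {((ν : ProbabilityMeasure Config) : Measure Config) | ν ∈ Set.range μ'} := by
    refine isTightMeasureSet_of_count (fun i => η i + 2 * totalInteraction a ρ * weight ρ i * t) ?_
    rintro _ ⟨_, ⟨M, rfl⟩, rfl⟩ i n hn
    have := hμ M
    exact measure_count_ge_le hr M ht η (hint M) i hn
  have hc := isCompact_closure_of_isTightMeasureSet htight
  -- A limit along an ultrafilter suffices: on cylinder observables the integrals converge along the
  -- full sequence, so the limit there does not depend on `U`.
  let U : Ultrafilter ℕ := Ultrafilter.of atTop
  obtain ⟨ν, -, hν⟩ := hc.ultrafilter_le_nhds (U.map μ') (by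
    rw [le_principal_iff, Ultrafilter.mem_coe, Ultrafilter.mem_map]
    exact Filter.univ_mem' fun M => subset_closure (Set.mem_range_self M))
  refine ⟨ν, inferInstance, fun m f hf => ?_⟩
  have hlim : Tendsto μ' (U : Filter ℕ) (𝓝 ν) := hν
  have h1 := ProbabilityMeasure.tendsto_iff_forall_integral_tendsto.1 hlim f
  have h2 : Tendsto (fun M => boxSemigroup r M t f η) (U : Filter ℕ)
      (𝓝 (limitSemigroup r t f η)) :=
    (((BoundedContinuousFunction.evalCLM ℝ η : Obs →L[ℝ] ℝ).continuous.tendsto _).comp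
      (tendsto_limitSemigroup hr hf ht)).mono_left (Ultrafilter.of_le atTop)
  refine tendsto_nhds_unique h1 (h2.congr fun M => ?_)
  exact hint M f

end Tightness

/-! ### Cylinder observables determine measures -/

section Cylinders

theorem exists_subset_box (B : Finset ℤ) : ∃ m, B ⊆ box m :=
  ⟨B.sup Int.natAbs, fun _ hi => mem_box.2 (Finset.le_sup (f := Int.natAbs) hi)⟩

theorem continuous_of_dependsOn {f : Config → ℝ} {B : Finset ℤ} (hf : DependsOn f (B : Set ℤ)) :
    Continuous f := by
  obtain ⟨g, rfl⟩ := dependsOn_iff_exists_comp.1 hf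
  exact (continuous_of_discreteTopology (f := g)).comp
    (continuous_pi fun i => continuous_apply (i : ℤ))

theorem IsBoundedCylinder.exists_mem_cyl {f : Config → ℝ} (hf : IsBoundedCylinder f) :
    ∃ m, ∃ F ∈ cyl m, (F : Config → ℝ) = f := by
  obtain ⟨⟨C, hC⟩, B, hB⟩ := hf
  obtain ⟨m, hm⟩ := exists_subset_box B
  exact ⟨m, BoundedContinuousFunction.ofNormedAddCommGroup f (continuous_of_dependsOn hB) C hC,
    hB.mono hm, rfl⟩

theorem isBoundedCylinder_of_mem_cyl {m : ℕ} {F : Obs} (hF : F ∈ cyl m) : IsBoundedCylinder F :=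
  ⟨⟨‖F‖, F.norm_coe_le_norm⟩, box m, hF⟩

/-- Sites carry the discrete topology, so indicators of cylinder sets are already continuous and
need no approximation. -/
theorem exists_obs_eq_indicator {A : Set Config} (hA : A ∈ measurableCylinders fun _ : ℤ => ℕ) :
    ∃ m, ∃ F ∈ cyl m, (F : Config → ℝ) = A.indicator 1 := by
  obtain ⟨B, S, -, rfl⟩ := (mem_measurableCylinders _).1 hA
  refine IsBoundedCylinder.exists_mem_cyl ⟨⟨1, fun η => ?_⟩, B, fun x y h => ?_⟩
  · by_cases hη : η ∈ cylinder B S <;> simp [hη]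
  · have : B.restrict x = B.restrict y := funext fun i => h i i.2
    have hiff : x ∈ cylinder B S ↔ y ∈ cylinder B S := by
      rw [mem_cylinder, mem_cylinder, this]
    by_cases hy : y ∈ cylinder B S <;> simp [hiff, hy]

theorem measure_eq_ofReal_integral (μ : Measure Config) [IsFiniteMeasure μ] {A : Set Config}
    (hA : MeasurableSet A) {F : Obs} (hF : (F : Config → ℝ) = A.indicator 1) :
    μ A = ENNReal.ofReal (∫ ζ, F ζ ∂μ) := by
  rw [hF, integral_indicator_one hA, measureReal_def, ENNReal.ofReal_toReal (measure_ne_top μ A)]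

theorem measure_ext_of_cyl {μ ν : Measure Config} [IsProbabilityMeasure μ]
    [IsProbabilityMeasure ν] (h : ∀ m, ∀ f ∈ cyl m, ∫ ζ, f ζ ∂μ = ∫ ζ, f ζ ∂ν) : μ = ν := by
  refine ext_of_generate_finite (measurableCylinders fun _ : ℤ => ℕ)
    generateFrom_measurableCylinders.symm isPiSystem_measurableCylinders (fun A hA => ?_)
    (by simp)
  obtain ⟨m, F, hF, hFA⟩ := exists_obs_eq_indicator hA
  have hm := MeasurableSet.of_mem_measurableCylinders hA
  rw [measure_eq_ofReal_integral μ hm hFA, measure_eq_ofReal_integral ν hm hFA, h m F hF]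

end Cylinders

/-! ### The limiting kernels and their semigroup property -/

section LimitKernel

variable {r : ℤ × ℤ → Obs} {a ρ : ℝ}

/-- The transition kernels of the infinite system. -/
def limitKernel (hr : IsJumpRate r a ρ) (t : ℝ≥0) : Kernel Config Config where
  toFun η := (exists_limitMeasure hr t.2 η).choose
  measurable' := by
    have hp : ∀ η, IsProbabilityMeasure (exists_limitMeasure hr t.2 η).choose :=
      fun η => (exists_limitMeasure hr t.2 η).choose_spec.1
    refine Measurable.measure_of_isPiSystem_of_isProbabilityMeasure
      generateFrom_measurableCylinders.symm isPiSystem_measurableCylinders fun A hA => ?_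
    obtain ⟨m, F, hF, hFA⟩ := exists_obs_eq_indicator hA
    have hm := MeasurableSet.of_mem_measurableCylinders hA
    have : (fun η => (exists_limitMeasure hr t.2 η).choose A) =
        fun η => ENNReal.ofReal (limitSemigroup r t F η) := funext fun η => by
      rw [measure_eq_ofReal_integral _ hm hFA,
        (exists_limitMeasure hr t.2 η).choose_spec.2 m F hF]
      rfl
    rw [this]
    exact (limitSemigroup r t F).continuous.measurable.ennreal_ofReal

theorem isMarkovKernel_limitKernel (hr : IsJumpRate r a ρ) (t : ℝ≥0) :
    IsMarkovKernel (limitKernel hr t) :=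
  ⟨fun η => (exists_limitMeasure hr t.2 η).choose_spec.1⟩

theorem integral_limitKernel (hr : IsJumpRate r a ρ) (t : ℝ≥0) {m : ℕ} {f : Obs} (hf : f ∈ cyl m)
    (η : Config) : ∫ ζ, f ζ ∂(limitKernel hr t η) = limitSemigroup r t f η :=
  (exists_limitMeasure hr t.2 η).choose_spec.2 m f hf

theorem abs_integral_sub_integral_le (μ : Measure Config) [IsProbabilityMeasure μ] (f g : Obs) :
    |∫ ζ, f ζ ∂μ - ∫ ζ, g ζ ∂μ| ≤ ‖f - g‖ := by
  rw [← integral_sub (f.integrable μ) (g.integrable μ)]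
  exact (f - g).norm_integral_le_norm μ

theorem limitKernel_zero (hr : IsJumpRate r a ρ) : limitKernel hr 0 = Kernel.id := by
  have := isMarkovKernel_limitKernel hr
  refine Kernel.ext fun η => measure_ext_of_cyl fun m f hf => ?_
  rw [integral_limitKernel hr 0 hf, Kernel.id_apply, integral_dirac]
  have h := tendsto_limitSemigroup hr hf (t := 0) le_rfl
  simp only [boxSemigroup_zero] at h
  rw [NNReal.coe_zero, tendsto_nhds_unique h tendsto_const_nhds]
  rfl

/-- The observable `limitSemigroup r t f` need not be a cylinder one. It is replaced by the box
evolution `g`, which is, and whose influence exceeds that of `f` by at most an exponential factor;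
both errors are then `O(ρ ^ M)`. -/
theorem integral_limitSemigroup (hr : IsJumpRate r a ρ) (t u : ℝ≥0) {m : ℕ} {f : Obs}
    (hf : f ∈ cyl m) (η : Config) :
    ∫ ζ, limitSemigroup r t f ζ ∂(limitKernel hr u η) = limitSemigroup r (t + u) f η := by
  have := isMarkovKernel_limitKernel hr
  have h1 : Tendsto (fun M => boxSemigroup r M (t + u) f η) atTop
      (𝓝 (limitSemigroup r (t + u) f η)) :=
    ((BoundedContinuousFunction.evalCLM ℝ η : Obs →L[ℝ] ℝ).continuous.tendsto _).comp
      (tendsto_limitSemigroup hr hf (add_nonneg t.2 u.2))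
  have h2 : Tendsto (fun M => boxSemigroup r M (t + u) f η) atTop
      (𝓝 (∫ ζ, limitSemigroup r t f ζ ∂(limitKernel hr u η))) := by
    rw [tendsto_iff_norm_sub_tendsto_zero]
    refine squeeze_zero' (Eventually.of_forall fun M => norm_nonneg _) ?_
      (tendsto_rho_pow hr (errorConst a ρ t + errorConst a ρ u *
        Real.exp (2 * totalInteraction a ρ * t)) (influence ρ m f))
    filter_upwards [eventually_ge_atTop m] with M hM
    have hfM := cyl_mono hM hf
    set g := boxSemigroup r M t f with hg
    have hgM : g ∈ cyl M := boxSemigroup_mem_cyl hr _ hfM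
    have e1 : boxSemigroup r M (t + u) f = boxSemigroup r M u g := by
      rw [add_comm, boxSemigroup_add]; rfl
    have e2 := abs_integral_sub_integral_le (limitKernel hr u η) (limitSemigroup r t f) g
    have e3 := norm_limitSemigroup_sub_le hr t.2 hfM
    have e4 := ((limitSemigroup r u g - boxSemigroup r M u g).norm_coe_le_norm η).trans
      (norm_limitSemigroup_sub_le hr u.2 hgM)
    have e5 := influence_boxSemigroup_le hr M t.2 f
    rw [integral_limitKernel hr u hgM] at e2
    rw [Real.norm_eq_abs, e1, abs_sub_comm]
    have hρ := pow_nonneg hr.rho_pos.le M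
    have hu := errorConst_nonneg hr u.2
    calc |∫ ζ, limitSemigroup r t f ζ ∂(limitKernel hr u η) - boxSemigroup r M u g η|
        ≤ |∫ ζ, limitSemigroup r t f ζ ∂(limitKernel hr u η) - limitSemigroup r u g η| +
          |limitSemigroup r u g η - boxSemigroup r M u g η| := abs_sub_le _ _ _
      _ ≤ errorConst a ρ t * ρ ^ M * influence ρ M f +
          errorConst a ρ u * ρ ^ M *
            (Real.exp (2 * totalInteraction a ρ * t) * influence ρ M f) := by
          refine add_le_add (e2.trans e3) (e4.trans ?_)
          exact mul_le_mul_of_nonneg_left e5 (mul_nonneg hu hρ)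
      _ = _ := by rw [influence_eq_of_le ρ hM hf]; ring
  exact tendsto_nhds_unique h2 h1

theorem limitKernel_add (hr : IsJumpRate r a ρ) (t u : ℝ≥0) :
    limitKernel hr (t + u) = limitKernel hr t ∘ₖ limitKernel hr u := by
  have := isMarkovKernel_limitKernel hr
  refine Kernel.ext fun η => measure_ext_of_cyl fun m f hf => ?_
  rw [Kernel.integral_comp (f.integrable _), integral_limitKernel hr _ hf]
  simp only [integral_limitKernel hr t hf]
  rw [integral_limitSemigroup hr t u hf, NNReal.coe_add]

end LimitKernel

/-! ### The forward equation of the infinite system -/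

section Forward

variable {r : ℤ × ℤ → Obs} {a ρ : ℝ}

/-- The generator maps cylinder observables to bounded continuous ones. -/
theorem exists_obs_eq_genAll (hr : IsJumpRate r a ρ) {m : ℕ} {f : Obs} (hf : f ∈ cyl m) :
    ∃ G : Obs, (G : Config → ℝ) = genAll r f ∧
      Tendsto (fun M => genOn r (boxPairs M) f) atTop (𝓝 G) := by
  have hb : ∀ M, m ≤ M → ∀ η, |genAll r f η - genOn r (boxPairs M) f η| ≤
      2 * totalInteraction a ρ * ρ ^ M * influence ρ m f := fun M hM η => by
    rw [← influence_eq_of_le ρ hM hf]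
    exact abs_genAll_sub_le hr (cyl_mono hM hf) η
  have hunif : TendstoUniformly (fun M => (genOn r (boxPairs M) f : Config → ℝ)) (genAll r f)
      atTop := by
    rw [Metric.tendstoUniformly_iff]
    intro ε hε
    filter_upwards [(tendsto_rho_pow hr (2 * totalInteraction a ρ) (influence ρ m f)).eventually
      (gt_mem_nhds hε), eventually_ge_atTop m] with M hM hmM η
    exact (hb M hmM η).trans_lt hM
  have hcont : Continuous (genAll r f) :=
    hunif.continuous (Frequently.of_forall fun M => (genOn r (boxPairs M) f).continuous)
  refine ⟨BoundedContinuousFunction.ofNormedAddCommGroup (genAll r f) hcont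
    (‖genOn r (boxPairs m) f‖ + 2 * totalInteraction a ρ * ρ ^ m * influence ρ m f) fun η => ?_,
    rfl, BoundedContinuousFunction.tendsto_iff_tendstoUniformly.2 hunif⟩
  have h1 := hb m le_rfl η
  have h2 := (genOn r (boxPairs m) f).norm_coe_le_norm η
  rw [Real.norm_eq_abs] at h2 ⊢
  have := abs_sub_abs_le_abs_sub (genAll r f η) (genOn r (boxPairs m) f η)
  linarith

theorem abs_integral_genAll_sub_le (hr : IsJumpRate r a ρ) {M : ℕ} {f : Obs} (hf : f ∈ cyl M)
    (μ : Measure Config) [IsProbabilityMeasure μ] :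
    |∫ ζ, genAll r f ζ ∂μ - ∫ ζ, genOn r (boxPairs M) f ζ ∂μ| ≤
      2 * totalInteraction a ρ * ρ ^ M * influence ρ M f := by
  obtain ⟨G, hG, -⟩ := exists_obs_eq_genAll hr hf
  rw [← hG]
  refine (abs_integral_sub_integral_le μ G _).trans ?_
  have h1 := totalInteraction_nonneg hr.a_nonneg hr.rho_pos
  have h2 := influence_nonneg hr.rho_pos M f
  have h3 := hr.rho_pos
  rw [BoundedContinuousFunction.norm_le (by positivity)]
  intro η
  have := abs_genAll_sub_le hr hf η
  rwa [← hG] at this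

/-- The law at the (real) time `s`, frozen at time `0` for negative `s`. -/
def lawAt (hr : IsJumpRate r a ρ) (η : Config) (s : ℝ) : Measure Config :=
  limitKernel hr s.toNNReal η

instance (hr : IsJumpRate r a ρ) (η : Config) (s : ℝ) : IsProbabilityMeasure (lawAt hr η s) :=
  (isMarkovKernel_limitKernel hr s.toNNReal).isProbabilityMeasure η

theorem integral_lawAt (hr : IsJumpRate r a ρ) (η : Config) {s : ℝ} (hs : 0 ≤ s) {m : ℕ} {f : Obs}
    (hf : f ∈ cyl m) : ∫ ζ, f ζ ∂(lawAt hr η s) = limitSemigroup r s f η := by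
  rw [lawAt, integral_limitKernel hr _ hf, Real.coe_toNNReal s hs]

theorem tendsto_boxSemigroup_lawAt (hr : IsJumpRate r a ρ) (η : Config) {s : ℝ} (hs : 0 ≤ s)
    {m : ℕ} {f : Obs} (hf : f ∈ cyl m) :
    Tendsto (fun M => boxSemigroup r M s f η) atTop (𝓝 (∫ ζ, f ζ ∂(lawAt hr η s))) := by
  rw [integral_lawAt hr η hs hf]
  exact ((BoundedContinuousFunction.evalCLM ℝ η : Obs →L[ℝ] ℝ).continuous.tendsto _).comp
    (tendsto_limitSemigroup hr hf hs)

/-- The finite systems are Lipschitz in time with a constant independent of `M`. Freezing the law at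
negative times extends this to all of `ℝ`, so two-sided calculus is available at `t = 0`. -/
theorem continuous_integral_lawAt (hr : IsJumpRate r a ρ) (η : Config) {m : ℕ} {f : Obs}
    (hf : f ∈ cyl m) : Continuous fun s => ∫ ζ, f ζ ∂(lawAt hr η s) := by
  set C := 2 * totalInteraction a ρ * influence ρ m f
  have hC : 0 ≤ C := mul_nonneg (mul_nonneg zero_le_two
    (totalInteraction_nonneg hr.a_nonneg hr.rho_pos)) (influence_nonneg hr.rho_pos m f)
  have h0 : ∀ s u : ℝ, 0 ≤ s → s ≤ u →
      |limitSemigroup r u f η - limitSemigroup r s f η| ≤ C * (u - s) := by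
    intro s u hs hsu
    have h1 := tendsto_boxSemigroup_lawAt hr η (hs.trans hsu) hf
    have h2 := tendsto_boxSemigroup_lawAt hr η hs hf
    rw [integral_lawAt hr η (hs.trans hsu) hf] at h1
    rw [integral_lawAt hr η hs hf] at h2
    refine le_of_tendsto' (h1.sub h2).abs fun M => ?_
    exact ((boxSemigroup r M u f - boxSemigroup r M s f).norm_coe_le_norm η).trans
      (norm_boxSemigroup_sub_self_le hr M hf hs hsu)
  have hle : ∀ s u : ℝ, s ≤ u → dist (∫ ζ, f ζ ∂(lawAt hr η u)) (∫ ζ, f ζ ∂(lawAt hr η s)) ≤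
      C * dist u s := by
    intro s u hsu
    rw [lawAt, lawAt, integral_limitKernel hr _ hf, integral_limitKernel hr _ hf,
      Real.dist_eq, Real.dist_eq, abs_of_nonneg (sub_nonneg.2 hsu), Real.coe_toNNReal',
      Real.coe_toNNReal']
    refine (h0 _ _ (le_max_right _ _) (max_le_max_right 0 hsu)).trans
      (mul_le_mul_of_nonneg_left ?_ hC)
    rcases le_total s 0 with h | h <;> rcases le_total u 0 with h' | h' <;> simp [h, h'] <;> linarith
  refine (LipschitzWith.of_dist_le' (K := C) fun u s => ?_).continuous
  rcases le_total s u with h | h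
  · exact hle s u h
  · rw [dist_comm, dist_comm u s]; exact hle u s h

/-- Uniform limits of cylinder observables inherit the convergence of the finite systems. -/
theorem tendsto_boxSemigroup_lawAt_of_tendsto (hr : IsJumpRate r a ρ) (η : Config) {s : ℝ}
    (hs : 0 ≤ s) {g : ℕ → Obs} (hg : ∀ k, ∃ m, g k ∈ cyl m) {G : Obs}
    (hG : Tendsto g atTop (𝓝 G)) :
    Tendsto (fun M => boxSemigroup r M s (g M) η) atTop (𝓝 (∫ ζ, G ζ ∂(lawAt hr η s))) := by
  rw [Metric.tendsto_atTop]
  intro ε hε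
  obtain ⟨K, hK⟩ := Metric.tendsto_atTop.1 hG (ε / 4) (by positivity)
  obtain ⟨m, hm⟩ := hg K
  obtain ⟨N, hN⟩ := Metric.tendsto_atTop.1 (tendsto_boxSemigroup_lawAt hr η hs hm) (ε / 4)
    (by positivity)
  refine ⟨max K N, fun M hM => ?_⟩
  have h1 := hN M ((le_max_right _ _).trans hM)
  have h2 := hK K le_rfl
  have h3 := hK M ((le_max_left _ _).trans hM)
  have h4 := abs_integral_sub_integral_le (lawAt hr η s) (g K) G
  have h5 : |boxSemigroup r M s (g M) η - boxSemigroup r M s (g K) η| ≤ ‖g M - g K‖ := by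
    have h := ((boxSemigroup r M s (g M - g K)).norm_coe_le_norm η).trans
      (norm_boxSemigroup_le hr M hs (g M - g K))
    rw [map_sub] at h
    exact h
  have h6 : ‖g M - g K‖ ≤ dist (g M) G + dist (g K) G := by
    rw [← dist_eq_norm]; exact dist_triangle_right _ _ _
  rw [← dist_eq_norm] at h4
  calc dist (boxSemigroup r M s (g M) η) (∫ ζ, G ζ ∂(lawAt hr η s))
      ≤ dist (boxSemigroup r M s (g M) η) (boxSemigroup r M s (g K) η) +
        dist (boxSemigroup r M s (g K) η) (∫ ζ, g K ζ ∂(lawAt hr η s)) +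
        dist (∫ ζ, g K ζ ∂(lawAt hr η s)) (∫ ζ, G ζ ∂(lawAt hr η s)) := dist_triangle4 _ _ _ _
    _ ≤ (ε / 4 + ε / 4) + dist (boxSemigroup r M s (g K) η) (∫ ζ, g K ζ ∂(lawAt hr η s)) +
        ε / 4 := by
        gcongr
        · exact h5.trans (h6.trans (add_le_add h3.le h2.le))
        · exact h4.trans h2.le
    _ < ε := by linarith

theorem exists_mem_cyl_genOn (hr : IsJumpRate r a ρ) {m : ℕ} {f : Obs} (hf : f ∈ cyl m) (M : ℕ) :
    ∃ k, genOn r (boxPairs M) f ∈ cyl k := by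
  refine ⟨max m M, fun x y h => ?_⟩
  rw [genOn_apply, genOn_apply]
  refine Finset.sum_congr rfl fun p hp => ?_
  have hp' := Finset.mem_product.1 hp
  have h1 : r p x = r p y := hr.dependsOn p fun i hi => h i (by
    have h3 := mem_box.1 hp'.1
    have h4 := mem_box.1 hp'.2
    have := hi.1
    have := hi.2
    exact Finset.mem_coe.2 (mem_box.2 (by omega)))
  have hfm := cyl_mono (le_max_left m M) hf
  have h2 : f (moveParticle x p.1 p.2) = f (moveParticle y p.1 p.2) := hfm fun i hi => by
    simp only [moveParticle, h i hi]
  rw [h1, h2, hfm h]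

theorem continuous_integral_genAll_lawAt (hr : IsJumpRate r a ρ) (η : Config) {m : ℕ} {f : Obs}
    (hf : f ∈ cyl m) : Continuous fun s => ∫ ζ, genAll r f ζ ∂(lawAt hr η s) := by
  obtain ⟨G, hG, hlim⟩ := exists_obs_eq_genAll hr hf
  rw [← hG]
  have hunif : TendstoUniformly (fun M s => ∫ ζ, genOn r (boxPairs M) f ζ ∂(lawAt hr η s))
      (fun s => ∫ ζ, G ζ ∂(lawAt hr η s)) atTop := by
    rw [Metric.tendstoUniformly_iff]
    intro ε hε
    filter_upwards [(Metric.tendsto_nhds.1 hlim) ε hε] with M hM s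
    rw [dist_comm, dist_eq_norm] at hM
    exact (abs_integral_sub_integral_le _ _ _).trans_lt hM
  refine hunif.continuous (Frequently.of_forall fun M => ?_)
  obtain ⟨k, hk⟩ := exists_mem_cyl_genOn hr hf M
  exact continuous_integral_lawAt hr η hk

/-- The integrated forward equations of the finite systems pass to the limit by dominated
convergence. Both the semigroup and the truncated generator vary with `M`; uniform convergence of
the latter and contractivity handle this. -/
theorem integral_lawAt_eq (hr : IsJumpRate r a ρ) (η : Config) {m : ℕ} {f : Obs}
    (hf : f ∈ cyl m) {t : ℝ} (ht : 0 ≤ t) :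
    ∫ ζ, f ζ ∂(lawAt hr η t) = f η + ∫ s in (0 : ℝ)..t, ∫ ζ, genAll r f ζ ∂(lawAt hr η s) := by
  obtain ⟨G, hG, hlim⟩ := exists_obs_eq_genAll hr hf
  have hcont : ∀ M, Continuous fun s => boxFunctional r M η s (genOn r (boxPairs M) f) :=
    fun M => continuous_iff_continuousAt.2 fun s =>
      (hasDerivAt_boxFunctional r M η (genOn r (boxPairs M) f) s).continuousAt
  have h1 : ∀ M, ∫ s in (0 : ℝ)..t, boxFunctional r M η s (genOn r (boxPairs M) f) =
      boxSemigroup r M t f η - f η := fun M => by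
    rw [intervalIntegral.integral_eq_sub_of_hasDerivAt
      (fun s _ => hasDerivAt_boxFunctional r M η f s) ((hcont M).intervalIntegrable _ _)]
    simp [boxFunctional_apply, boxSemigroup_zero]
  have h2 : Tendsto (fun M => ∫ s in (0 : ℝ)..t, boxFunctional r M η s (genOn r (boxPairs M) f))
      atTop (𝓝 (∫ s in (0 : ℝ)..t, ∫ ζ, genAll r f ζ ∂(lawAt hr η s))) := by
    refine intervalIntegral.tendsto_integral_filter_of_dominated_convergence
      (fun _ => 2 * totalInteraction a ρ * influence ρ m f)
      (Eventually.of_forall fun M => (hcont M).aestronglyMeasurable)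
      (Eventually.of_forall fun M => ae_of_all _ fun s hs => ?_) (by simp)
      (ae_of_all _ fun s hs => ?_)
    · rw [Set.uIoc_of_le ht] at hs
      exact (abs_boxFunctional_le hr M η hs.1.le _).trans (norm_genOn_le hr hf _)
    · rw [Set.uIoc_of_le ht] at hs
      rw [← hG]
      exact tendsto_boxSemigroup_lawAt_of_tendsto hr η hs.1.le
        (fun M => exists_mem_cyl_genOn hr hf M) hlim
  have h3 := (tendsto_boxSemigroup_lawAt hr η ht hf).sub_const (f η)
  simp only [h1] at h2
  linarith [tendsto_nhds_unique h2 h3]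

theorem hasDerivWithinAt_integral_lawAt (hr : IsJumpRate r a ρ) (η : Config) {m : ℕ} {f : Obs}
    (hf : f ∈ cyl m) {t : ℝ} (ht : 0 ≤ t) :
    HasDerivWithinAt (fun u => ∫ ζ, f ζ ∂(lawAt hr η u))
      (∫ ζ, genAll r f ζ ∂(lawAt hr η t)) (Set.Ici 0) t := by
  have h := ((continuous_integral_genAll_lawAt hr η hf).integral_hasStrictDerivAt 0
    t).hasDerivAt.const_add (f η)
  exact h.hasDerivWithinAt.congr (fun u hu => integral_lawAt_eq hr η hf hu)
    (integral_lawAt_eq hr η hf ht)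

end Forward

/-! ### Uniqueness and a criterion for invariance -/

section Uniqueness

variable {r : ℤ × ℤ → Obs} {a ρ : ℝ}

/-- Integration of observables. -/
def integralFunctional (μ : Measure Config) [IsProbabilityMeasure μ] : Obs →ₗ[ℝ] ℝ where
  toFun f := ∫ ζ, f ζ ∂μ
  map_add' f g := integral_add (f.integrable μ) (g.integrable μ)
  map_smul' c f := integral_const_mul c f

theorem abs_integralFunctional_le (μ : Measure Config) [IsProbabilityMeasure μ] (f : Obs) :
    |integralFunctional μ f| ≤ ‖f‖ :=
  f.norm_integral_le_norm μ

/-- Solutions of the forward equation on cylinder observables are unique. -/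
theorem eq_limitKernel_of_forward (hr : IsJumpRate r a ρ) {P : ℝ≥0 → Kernel Config Config}
    (hP : ∀ t, IsMarkovKernel (P t)) (h0 : P 0 = Kernel.id)
    (hfwd : ∀ m, ∀ f ∈ cyl m, ∀ (η : Config) (t : ℝ≥0),
      HasDerivWithinAt (fun u : ℝ => ∫ ζ, f ζ ∂(P u.toNNReal η))
        (∫ ζ, genAll r f ζ ∂(P t η)) (Set.Ici 0) t) : P = limitKernel hr := by
  funext t
  have := isMarkovKernel_limitKernel hr t
  refine Kernel.ext fun η => measure_ext_of_cyl fun m f hf => ?_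
  rw [integral_limitKernel hr t hf]
  have key := functional_eq_limitSemigroup hr t.2
    (fun s => integralFunctional (P s.toNNReal η))
    (fun s g => ∫ ζ, genAll r g ζ ∂(P s.toNNReal η))
    (fun s _ g => abs_integralFunctional_le _ g)
    (fun M g hg s hs => by
      have h := hfwd M g hg η s.toNNReal
      rw [Real.coe_toNNReal s hs] at h
      exact h)
    (fun M g hg s _ => abs_integral_genAll_sub_le hr hg _) hf
  have e1 : integralFunctional (P (t : ℝ).toNNReal η) f = ∫ ζ, f ζ ∂(P t η) := by
    rw [integralFunctional]; simp [Real.toNNReal_coe]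
  have e2 : ∀ g : Obs, integralFunctional (P (0 : ℝ).toNNReal η) g = g η := fun g => by
    rw [integralFunctional]; simp [h0, Kernel.id_apply]
  rw [← e1, ← e2]
  exact key

/-- A measure that is infinitesimally invariant for the finite systems in the limit is invariant. -/
theorem invariant_limitKernel (hr : IsJumpRate r a ρ) (μ : Measure Config) [IsProbabilityMeasure μ]
    (h : ∀ m, ∀ f ∈ cyl m,
      Tendsto (fun M => ∫ ζ, genOn r (boxPairs M) f ζ ∂μ) atTop (𝓝 0)) (t : ℝ≥0) :
    Kernel.Invariant (limitKernel hr t) μ := by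
  have := isMarkovKernel_limitKernel hr t
  refine measure_ext_of_cyl fun m f hf => ?_
  have hint : ∫ ζ, f ζ ∂(μ.bind (limitKernel hr t)) = ∫ ζ, limitSemigroup r t f ζ ∂μ := by
    have h1 := Kernel.integral_comp (η := limitKernel hr t) (κ := Kernel.const Unit μ) (a := ())
      (f.integrable _)
    rw [Kernel.comp_const] at h1
    simpa [integral_limitKernel hr t hf] using h1
  rw [hint]
  -- The constant family `s ↦ μ` is treated as a solution of the forward equation with zero
  -- derivative, so the comparison yields that integrals of `f` and of its evolution agree.
  refine (functional_eq_limitSemigroup hr t.2 (fun _ => integralFunctional μ) (fun _ _ => 0)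
    (fun s _ g => abs_integralFunctional_le _ g)
    (fun M g _ s _ => hasDerivWithinAt_const _ _ _)
    (fun M g hg s _ => ?_) hf).symm
  -- What is required is that `∫ genOn r (boxPairs M) g ∂μ` be of the size of the truncation error.
  -- Subtract the integrals for larger boxes `M'`, which tend to `0`.
  refine le_of_tendsto (((h M g hg).sub_const _).abs) ((eventually_ge_atTop M).mono fun M' hM' => ?_)
  exact (abs_integral_sub_integral_le μ _ _).trans (norm_genOn_sub_le hr hg (boxPairs_mono hM'))

end Uniqueness

/-! ### The vertex model as a system with decaying jump rates -/

section Rates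

variable {q s ξ : ℝ}

theorem rate_bounds (hq : 0 < q ∧ q < 1) (n : ℕ) : 0 < q ^ n ∧ q ^ n ≤ 1 :=
  ⟨pow_pos hq.1 n, pow_le_one₀ hq.1.le hq.2.le⟩

/-- The observable `q ^ η k`. -/
def qCount (hq : 0 < q ∧ q < 1) (k : ℤ) : Obs :=
  BoundedContinuousFunction.ofNormedAddCommGroup (fun η : Config => q ^ η k)
    ((continuous_of_discreteTopology (f := fun n : ℕ => q ^ n)).comp (continuous_apply k)) 1
    fun η => by
      rw [Real.norm_of_nonneg (rate_bounds hq _).1.le]; exact (rate_bounds hq _).2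

theorem qCount_apply (hq : 0 < q ∧ q < 1) (k : ℤ) (η : Config) : qCount hq k η = q ^ η k := rfl

/-- The jump rates of the half-continuous vertex model. -/
def jumpRate (hq : 0 < q ∧ q < 1) (s ξ : ℝ) (p : ℤ × ℤ) : Obs :=
  if p.1 < p.2 then (ξ * (-s)) • ((1 - qCount hq p.1) *
    ((∏ k ∈ Finset.Ioo p.1 p.2, (s ^ 2) • qCount hq k) * (1 - (s ^ 2) • qCount hq p.2))) else 0

theorem jumpRate_apply (hq : 0 < q ∧ q < 1) (s ξ : ℝ) (p : ℤ × ℤ) (η : Config) :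
    jumpRate hq s ξ p η = wakeUpRate q s ξ η p.1 * landingProb q s η p.1 p.2 := by
  rw [jumpRate, landingProb, wakeUpRate]
  split_ifs
  · simp [BoundedContinuousFunction.coe_prod, qCount_apply, mul_assoc]
  · simp

theorem prod_mem_Icc (hq : 0 < q ∧ q < 1) (s : ℝ) (η : Config) (I : Finset ℤ) :
    0 ≤ ∏ k ∈ I, s ^ 2 * q ^ η k ∧ ∏ k ∈ I, s ^ 2 * q ^ η k ≤ (s ^ 2) ^ I.card := by
  constructor
  · exact Finset.prod_nonneg fun k _ => mul_nonneg (sq_nonneg s) (rate_bounds hq _).1.le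
  · rw [← Finset.prod_const]
    exact Finset.prod_le_prod (fun k _ => mul_nonneg (sq_nonneg s) (rate_bounds hq _).1.le)
      fun k _ => mul_le_of_le_one_right (sq_nonneg s) (rate_bounds hq _).2

/-- Each intermediate site is passed with probability at most `s ^ 2 = (-s) ^ 2`, which produces the
exponent `2 * gap` for `ρ = -s`. -/
theorem isJumpRate_jumpRate (hq : 0 < q ∧ q < 1) (hs : -1 < s ∧ s < 0) (hξ : 0 < ξ) :
    IsJumpRate (jumpRate hq s ξ) (ξ * (-s)) (-s) where
  a_nonneg := mul_nonneg hξ.le (by linarith [hs.2])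
  rho_pos := by linarith [hs.2]
  rho_lt_one := by linarith [hs.1]
  nonneg p η := by
    have ha : 0 ≤ ξ * (-s) := mul_nonneg hξ.le (by linarith [hs.2])
    have h1 := rate_bounds hq (η p.1)
    have h2 := rate_bounds hq (η p.2)
    have h3 := prod_mem_Icc hq s η (Finset.Ioo p.1 p.2)
    have h4 : s ^ 2 * q ^ η p.2 ≤ 1 := mul_le_one₀ (sq_lt_one_of_mem hs).le h2.1.le h2.2
    rw [jumpRate_apply, wakeUpRate, landingProb]
    split_ifs
    · exact mul_nonneg (mul_nonneg ha (by linarith)) (mul_nonneg h3.1 (by linarith))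
    · simp
  le p η := by
    have ha : 0 ≤ ξ * (-s) := mul_nonneg hξ.le (by linarith [hs.2])
    have h1 := rate_bounds hq (η p.1)
    have h2 := rate_bounds hq (η p.2)
    have h3 := prod_mem_Icc hq s η (Finset.Ioo p.1 p.2)
    have h5 : 0 ≤ s ^ 2 * q ^ η p.2 := mul_nonneg (sq_nonneg s) h2.1.le
    have h4 : s ^ 2 * q ^ η p.2 ≤ 1 := mul_le_one₀ (sq_lt_one_of_mem hs).le h2.1.le h2.2
    rw [jumpRate_apply, wakeUpRate, landingProb, rateBound]
    split_ifs
    · have hcard : (s ^ 2) ^ (Finset.Ioo p.1 p.2).card = (-s) ^ (2 * gap p) := by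
        rw [Int.card_Ioo, pow_mul, neg_sq, gap]
      rw [hcard] at h3
      calc _ ≤ (ξ * (-s) * 1) * ((-s) ^ (2 * gap p) * 1) := by
            refine mul_le_mul (mul_le_mul_of_nonneg_left (by linarith) ha)
              (mul_le_mul h3.2 (by linarith) (by linarith) (h3.1.trans h3.2))
              (mul_nonneg h3.1 (by linarith)) (by linarith)
        _ = _ := by ring
    · simp
  dependsOn p x y h := by
    rw [jumpRate_apply, jumpRate_apply, wakeUpRate, wakeUpRate, landingProb, landingProb]
    split_ifs with hp
    · rw [h p.1 ⟨le_rfl, hp.le⟩, h p.2 ⟨hp.le, le_rfl⟩]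
      congr 2
      refine Finset.prod_congr rfl fun k hk => ?_
      rw [Finset.mem_Ioo] at hk
      rw [h k ⟨hk.1.le, hk.2.le⟩]
    · simp
  vacant p η h := by
    rw [jumpRate_apply, wakeUpRate, h]; simp

theorem generator_eq_genAll (hq : 0 < q ∧ q < 1) (s ξ : ℝ) (f : Obs) :
    generator q s ξ f = genAll (jumpRate hq s ξ) f := by
  funext η
  simp only [generator, genAll, jumpRate_apply]

end Rates

/-! ### Telescoping identities for the rates -/

section Telescoping

variable {R : Type*} [CommRing R]

/-- Read `y k` as the probability of passing `k` when moving left from `M`: stopping in `[A, m]`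
means passing `(m, M]` but not all of `[A, M]`. Allowing `A = m + 1` makes the empty sum the start
of the induction. -/
theorem sum_mul_prod_Ioc (y : ℤ → R) {m M : ℤ} (hmM : m ≤ M) {A : ℤ} (hA : A ≤ m + 1) :
    ∑ j ∈ Finset.Icc A m, (1 - y j) * ∏ k ∈ Finset.Ioc j M, y k =
      ∏ k ∈ Finset.Ioc m M, y k - ∏ k ∈ Finset.Icc A M, y k := by
  obtain ⟨n, rfl⟩ : ∃ n : ℕ, A = m + 1 - n := ⟨(m + 1 - A).toNat, by omega⟩
  clear hA
  induction n with
  | zero =>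
    have h1 : Finset.Icc (m + 1 - ((0 : ℕ) : ℤ)) m = ∅ := by simp
    have h2 : Finset.Icc (m + 1 - ((0 : ℕ) : ℤ)) M = Finset.Ioc m M := by
      ext k; simp only [Finset.mem_Icc, Finset.mem_Ioc]; omega
    rw [h1, h2]; simp
  | succ n ih =>
    set A : ℤ := m + 1 - (n : ℤ)
    have e : m + 1 - ((n + 1 : ℕ) : ℤ) = A - 1 := by push_cast; omega
    have h1 : Finset.Icc (A - 1) m = insert (A - 1) (Finset.Icc A m) := by
      ext k; simp only [Finset.mem_Icc, Finset.mem_insert]; omega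
    have h2 : Finset.Icc (A - 1) M = insert (A - 1) (Finset.Icc A M) := by
      ext k; simp only [Finset.mem_Icc, Finset.mem_insert]; omega
    have h3 : Finset.Ioc (A - 1) M = Finset.Icc A M := by
      ext k; simp only [Finset.mem_Icc, Finset.mem_Ioc]; omega
    rw [e, h1, h2, Finset.sum_insert (by simp), Finset.prod_insert (by simp), ih, h3]
    ring

theorem sum_mul_prod_Ico (y : ℤ → R) {m A : ℤ} (hmA : A ≤ m) {B : ℤ} (hB : m ≤ B + 1) :
    ∑ j ∈ Finset.Icc m B, (1 - y j) * ∏ k ∈ Finset.Ico A j, y k =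
      ∏ k ∈ Finset.Ico A m, y k - ∏ k ∈ Finset.Icc A B, y k := by
  obtain ⟨n, rfl⟩ : ∃ n : ℕ, B = m - 1 + n := ⟨(B + 1 - m).toNat, by omega⟩
  clear hB
  induction n with
  | zero =>
    have h1 : Finset.Icc m (m - 1 + ((0 : ℕ) : ℤ)) = ∅ := by simp
    have h2 : Finset.Icc A (m - 1 + ((0 : ℕ) : ℤ)) = Finset.Ico A m := by
      ext k; simp only [Finset.mem_Icc, Finset.mem_Ico]; omega
    rw [h1, h2]; simp
  | succ n ih =>
    set B : ℤ := m - 1 + (n : ℤ)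
    have e : m - 1 + ((n + 1 : ℕ) : ℤ) = B + 1 := by push_cast; omega
    have h1 : Finset.Icc m (B + 1) = insert (B + 1) (Finset.Icc m B) := by
      ext k; simp only [Finset.mem_Icc, Finset.mem_insert]; omega
    have h2 : Finset.Icc A (B + 1) = insert (B + 1) (Finset.Icc A B) := by
      ext k; simp only [Finset.mem_Icc, Finset.mem_insert]; omega
    have h3 : Finset.Ico A (B + 1) = Finset.Icc A B := by
      ext k; simp only [Finset.mem_Icc, Finset.mem_Ico]; omega
    rw [e, h1, h2, Finset.sum_insert (by simp), Finset.prod_insert (by simp), ih, h3]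
    ring

/-- The total rate balance between the jumps to the right and the time-reversed jumps. -/
theorem sum_reversed_sub_rates (x y : ℤ → R) (M : ℕ) :
    ∑ p ∈ boxPairs M, (if p.1 < p.2 then
      (1 - y p.1) * (∏ k ∈ Finset.Ioo p.1 p.2, y k) * (1 - x p.2) -
        (1 - x p.1) * (∏ k ∈ Finset.Ioo p.1 p.2, y k) * (1 - y p.2) else 0) =
    ∑ j ∈ box M, (1 - x j) * ∏ k ∈ Finset.Ioc j M, y k -
      ∑ j ∈ box M, (1 - x j) * ∏ k ∈ Finset.Ico (-(M : ℤ)) j, y k := by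
  -- Fix the site `j` from which the reversed jump starts: the probabilities of stopping inside the
  -- box sum to one minus that of escaping on the left. In `h2` forward jumps are treated alike on
  -- the right; the terms `1 - x j` cancel in the difference, leaving only escapes.
  have h1 : ∀ j ∈ box M, ∑ i ∈ box M, (if i < j then
      (1 - y i) * (∏ k ∈ Finset.Ioo i j, y k) * (1 - x j) else 0) =
      (1 - x j) - (1 - x j) * ∏ k ∈ Finset.Ico (-(M : ℤ)) j, y k := by
    intro j hj
    have hj' := Finset.mem_Icc.1 hj
    have hf : (box M).filter (· < j) = Finset.Icc (-(M : ℤ)) (j - 1) := by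
      ext k; simp only [box, Finset.mem_filter, Finset.mem_Icc]; omega
    have hI : ∀ i, Finset.Ioo i j = Finset.Ioc i (j - 1) := fun i => by
      ext k; simp only [Finset.mem_Ioo, Finset.mem_Ioc]; omega
    have hI' : Finset.Ico (-(M : ℤ)) j = Finset.Icc (-(M : ℤ)) (j - 1) := by
      ext k; simp only [Finset.mem_Ico, Finset.mem_Icc]; omega
    rw [← Finset.sum_filter, hf, ← Finset.sum_mul]
    simp only [hI, hI']
    rw [sum_mul_prod_Ioc y le_rfl (by omega), Finset.Ioc_self, Finset.prod_empty]
    ring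
  have h2 : ∀ i ∈ box M, ∑ j ∈ box M, (if i < j then
      (1 - x i) * (∏ k ∈ Finset.Ioo i j, y k) * (1 - y j) else 0) =
      (1 - x i) - (1 - x i) * ∏ k ∈ Finset.Ioc i (M : ℤ), y k := by
    intro i hi
    have hi' := Finset.mem_Icc.1 hi
    have hf : (box M).filter (i < ·) = Finset.Icc (i + 1) (M : ℤ) := by
      ext k; simp only [box, Finset.mem_filter, Finset.mem_Icc]; omega
    have hI : ∀ j, Finset.Ioo i j = Finset.Ico (i + 1) j := fun j => by
      ext k; simp only [Finset.mem_Ioo, Finset.mem_Ico]; omega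
    have hI' : Finset.Ioc i (M : ℤ) = Finset.Icc (i + 1) (M : ℤ) := by
      ext k; simp only [Finset.mem_Ioc, Finset.mem_Icc]; omega
    rw [← Finset.sum_filter, hf]
    simp only [hI, hI', mul_assoc]
    rw [← Finset.mul_sum]
    simp only [mul_comm (∏ k ∈ Finset.Ico (i + 1) _, y k)]
    rw [sum_mul_prod_Ico y le_rfl (by omega), Finset.Ico_self, Finset.prod_empty]
    ring
  have h3 : ∀ p : ℤ × ℤ, (if p.1 < p.2 then
      (1 - y p.1) * (∏ k ∈ Finset.Ioo p.1 p.2, y k) * (1 - x p.2) -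
        (1 - x p.1) * (∏ k ∈ Finset.Ioo p.1 p.2, y k) * (1 - y p.2) else 0) =
      (if p.1 < p.2 then (1 - y p.1) * (∏ k ∈ Finset.Ioo p.1 p.2, y k) * (1 - x p.2) else 0) -
      (if p.1 < p.2 then (1 - x p.1) * (∏ k ∈ Finset.Ioo p.1 p.2, y k) * (1 - y p.2) else 0) :=
    fun p => by split_ifs <;> simp
  rw [Finset.sum_congr rfl fun p _ => h3 p, Finset.sum_sub_distrib, boxPairs,
    Finset.sum_product_right, Finset.sum_product, Finset.sum_congr rfl h1, Finset.sum_congr rfl h2]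
  simp only [Finset.sum_sub_distrib]
  ring

end Telescoping

/-! ### Resampling and reflection under the product measure -/

section ProductMeasure

theorem infinitePi_map_update (ν : Measure ℕ) [IsProbabilityMeasure ν] (i : ℤ) :
    (ν.prod (Measure.infinitePi fun _ : ℤ => ν)).map
      (fun z : ℕ × Config => Function.update z.2 i z.1) = Measure.infinitePi fun _ : ℤ => ν := by
  have hmeas : Measurable fun z : ℕ × Config => Function.update z.2 i z.1 := by
    refine measurable_pi_lambda _ fun k => ?_
    by_cases hk : k = i
    · subst hk; simpa using measurable_fst
    · simpa [hk] using! (measurable_pi_apply k).comp measurable_snd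
  refine Measure.eq_infinitePi _ fun S t ht => ?_
  rw [Measure.map_apply hmeas (.pi S.countable_toSet fun k _ => ht k)]
  -- The update overwrites coordinate `i`, so the constraint at `i` falls on the fresh sample and
  -- the other constraints on the remaining sites.
  have hpre : (fun z : ℕ × Config => Function.update z.2 i z.1) ⁻¹' (Set.pi (S : Set ℤ) t) =
      (if i ∈ S then t i else Set.univ) ×ˢ Set.pi ((S.erase i : Finset ℤ) : Set ℤ) t := by
    ext ⟨n, η⟩
    simp only [Set.mem_preimage, Set.mem_pi, Set.mem_prod, Finset.mem_coe, Finset.mem_erase]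
    constructor
    · intro h
      refine ⟨?_, fun k hk => by simpa [hk.1] using h k hk.2⟩
      split_ifs with hi
      · simpa using h i hi
      · trivial
    · rintro ⟨h1, h2⟩ k hk
      by_cases hki : k = i
      · subst hki; simpa [hk] using h1
      · simpa [hki] using h2 k ⟨hki, hk⟩
  rw [hpre, Measure.prod_prod, Measure.infinitePi_pi _ fun k _ => ht k]
  by_cases hi : i ∈ S
  · rw [if_pos hi, Finset.mul_prod_erase S (fun k => ν (t k)) hi]
  · rw [if_neg hi, measure_univ, one_mul, Finset.erase_eq_of_notMem hi]

/-- Resampling one coordinate under a product measure. -/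
theorem integral_infinitePi_update (ν : Measure ℕ) [IsProbabilityMeasure ν] (i : ℤ) (H : Obs) :
    ∫ η, H η ∂(Measure.infinitePi fun _ : ℤ => ν) =
      ∫ η, ∫ n, H (Function.update η i n) ∂ν ∂(Measure.infinitePi fun _ : ℤ => ν) := by
  have hmeas : Measurable fun z : ℕ × Config => Function.update z.2 i z.1 := by
    refine measurable_pi_lambda _ fun k => ?_
    by_cases hk : k = i
    · subst hk; simpa using measurable_fst
    · simpa [hk] using! (measurable_pi_apply k).comp measurable_snd
  conv_lhs => rw [← infinitePi_map_update ν i]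
  rw [integral_map hmeas.aemeasurable H.continuous.measurable.aestronglyMeasurable,
    integral_prod_symm]
  exact Integrable.of_bound (H.continuous.measurable.comp hmeas).aestronglyMeasurable ‖H‖
    (ae_of_all _ fun z => H.norm_coe_le_norm _)

variable {q s c : ℝ}

/-- Adding a particle at a site under the product measure. -/
theorem integral_productMeasure_addParticle (hq : 0 < q ∧ q < 1) (hs : -1 < s ∧ s < 0)
    (hc : 0 ≤ c ∧ c < 1) (i : ℤ) {G G' : Obs} (hG : ∀ η, G' η = G (addParticle i η)) :
    ∫ η, ((1 - qCount hq i) * G) η ∂(productMeasure q s c) =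
      ∫ η, (c • (1 - (s ^ 2) • qCount hq i) * G') η ∂(productMeasure q s c) := by
  have := isProbabilityMeasure_siteMeasure hq hs hc
  rw [productMeasure, integral_infinitePi_update _ i, integral_infinitePi_update _ i]
  refine integral_congr_ae (ae_of_all _ fun η => ?_)
  have h := integral_siteMeasure_succ hq hs hc (g := fun n => G (Function.update η i n)) (C := ‖G‖)
    fun n => G.norm_coe_le_norm _
  have e : ∀ n, addParticle i (Function.update η i n) = Function.update η i (n + 1) := fun n => by
    simp [addParticle]
  simpa [qCount_apply, hG, e] using h

/-- Reflection of the sites outside `box m`. -/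
def outerReflection (m : ℕ) : ℤ ≃ ℤ where
  toFun k := if k.natAbs ≤ m then k else -k
  invFun k := if k.natAbs ≤ m then k else -k
  left_inv k := by by_cases h : k.natAbs ≤ m <;> simp [h]
  right_inv k := by by_cases h : k.natAbs ≤ m <;> simp [h]

theorem integral_outerReflection (ν : Measure ℕ) [IsProbabilityMeasure ν] (m : ℕ) (H : Obs) :
    ∫ η, H (fun k => η (outerReflection m k)) ∂(Measure.infinitePi fun _ : ℤ => ν) =
      ∫ η, H η ∂(Measure.infinitePi fun _ : ℤ => ν) := by
  have h := Measure.infinitePi_map_piCongrLeft (fun _ : ℤ => ν) (outerReflection m).symm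
  conv_rhs => rw [← h]
  rw [integral_map (by fun_prop) H.continuous.measurable.aestronglyMeasurable]
  refine integral_congr_ae (ae_of_all _ fun η => congrArg H (funext fun k => ?_))
  obtain ⟨k, rfl⟩ := (outerReflection m).symm.surjective k
  rw [MeasurableEquiv.coe_piCongrLeft, Equiv.piCongrLeft_apply_apply, Equiv.apply_symm_apply]

end ProductMeasure

/-! ### Stationarity: reversed jumps and boundary fluxes -/

section Stationarity

variable {q s ξ c : ℝ}

theorem isProbabilityMeasure_productMeasure (hq : 0 < q ∧ q < 1) (hs : -1 < s ∧ s < 0)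
    (hc : 0 ≤ c ∧ c < 1) : IsProbabilityMeasure (productMeasure q s c) := by
  have := isProbabilityMeasure_siteMeasure hq hs hc
  rw [productMeasure]
  infer_instance

/-- The product `∏_{k ∈ I} s² q^{η k}`. -/
def passObs (hq : 0 < q ∧ q < 1) (s : ℝ) (I : Finset ℤ) : Obs :=
  ∏ k ∈ I, (s ^ 2) • qCount hq k

theorem passObs_apply (hq : 0 < q ∧ q < 1) (s : ℝ) (I : Finset ℤ) (η : Config) :
    passObs hq s I η = ∏ k ∈ I, s ^ 2 * q ^ η k := by
  simp [passObs, BoundedContinuousFunction.coe_prod, qCount_apply]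

/-- The jump rates of the time-reversed system. -/
def reversedRate (hq : 0 < q ∧ q < 1) (s ξ : ℝ) (p : ℤ × ℤ) : Obs :=
  if p.1 < p.2 then (ξ * (-s)) • ((1 - (s ^ 2) • qCount hq p.1) *
    (passObs hq s (Finset.Ioo p.1 p.2) * (1 - qCount hq p.2))) else 0

/-- The composition of an observable with the jump from `i` to `j`. -/
def jumpObs (f : Obs) (p : ℤ × ℤ) : Obs :=
  f.compContinuous ⟨fun η => moveParticle η p.1 p.2, continuous_moveParticle p.1 p.2⟩

theorem jumpObs_apply (f : Obs) (p : ℤ × ℤ) (η : Config) :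
    jumpObs f p η = f (moveParticle η p.1 p.2) := rfl

theorem passObs_addParticle (hq : 0 < q ∧ q < 1) (s : ℝ) {I : Finset ℤ} {i : ℤ} (hi : i ∉ I)
    (η : Config) : passObs hq s I (addParticle i η) = passObs hq s I η := by
  rw [passObs_apply, passObs_apply]
  refine Finset.prod_congr rfl fun k hk => ?_
  have : k ≠ i := fun h => hi (h ▸ hk)
  simp [addParticle, this]

theorem qCount_addParticle (hq : 0 < q ∧ q < 1) {i k : ℤ} (hk : k ≠ i) (η : Config) :
    qCount hq k (addParticle i η) = qCount hq k η := by
  simp [qCount_apply, addParticle, hk]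

/-- Removing the particle at the source turns `1 - q ^ η i` into `c * (1 - s² q ^ η i)`, leaving `f`
evaluated with the particle at the target. Removing the target particle on the reversed side
produces the same expression, symmetric in the two endpoint factors. -/
theorem integral_jumpRate_mul_jumpObs (hq : 0 < q ∧ q < 1) (hs : -1 < s ∧ s < 0)
    (hc : 0 ≤ c ∧ c < 1) (f : Obs) (p : ℤ × ℤ) :
    ∫ η, (jumpRate hq s ξ p * jumpObs f p) η ∂(productMeasure q s c) =
      ∫ η, (reversedRate hq s ξ p * f) η ∂(productMeasure q s c) := by
  by_cases hp : p.1 < p.2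
  · set W := passObs hq s (Finset.Ioo p.1 p.2) with hW
    let f' : Obs := f.compContinuous ⟨addParticle p.2, continuous_addParticle p.2⟩
    have hf' : ∀ η, f' η = f (addParticle p.2 η) := fun η => rfl
    have hWi : ∀ η, W (addParticle p.1 η) = W η := passObs_addParticle hq s (by simp)
    have hWj : ∀ η, W (addParticle p.2 η) = W η := passObs_addParticle hq s (by simp)
    have h1 := integral_productMeasure_addParticle hq hs hc p.1
      (G := (ξ * (-s)) • (W * (1 - (s ^ 2) • qCount hq p.2) * jumpObs f p))
      (G' := (ξ * (-s)) • (W * (1 - (s ^ 2) • qCount hq p.2) * f')) (fun η => by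
        have := qCount_addParticle hq hp.ne' η
        simp [hWi, jumpObs_apply, moveParticle_addParticle hp.ne, hf', this])
    have h2 := integral_productMeasure_addParticle hq hs hc p.2
      (G := (ξ * (-s)) • (W * (1 - (s ^ 2) • qCount hq p.1) * f))
      (G' := (ξ * (-s)) • (W * (1 - (s ^ 2) • qCount hq p.1) * f')) (fun η => by
        have := qCount_addParticle hq hp.ne η
        simp [hWj, hf', this])
    have e1 : jumpRate hq s ξ p * jumpObs f p = (1 - qCount hq p.1) *
        ((ξ * (-s)) • (W * (1 - (s ^ 2) • qCount hq p.2) * jumpObs f p)) := by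
      ext η
      simp [jumpRate, hp, hW, passObs]
      ring
    have e2 : reversedRate hq s ξ p * f = (1 - qCount hq p.2) *
        ((ξ * (-s)) • (W * (1 - (s ^ 2) • qCount hq p.1) * f)) := by
      ext η
      simp [reversedRate, hp, hW]
      ring
    rw [e1, e2, h1, h2]
    congr 1
    ext η
    simp
    ring
  · simp [jumpRate, reversedRate, hp]

/-- The flux through the right end of `box M`. -/
def rightFlux (hq : 0 < q ∧ q < 1) (s : ℝ) (M : ℕ) (j : ℤ) : Obs :=
  (1 - qCount hq j) * passObs hq s (Finset.Ioc j M)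

/-- The flux through the left end of `box M`. -/
def leftFlux (hq : 0 < q ∧ q < 1) (s : ℝ) (M : ℕ) (j : ℤ) : Obs :=
  (1 - qCount hq j) * passObs hq s (Finset.Ico (-(M : ℤ)) j)

theorem rightFlux_apply (hq : 0 < q ∧ q < 1) (s : ℝ) (M : ℕ) (j : ℤ) (η : Config) :
    rightFlux hq s M j η = (1 - q ^ η j) * ∏ k ∈ Finset.Ioc j (M : ℤ), s ^ 2 * q ^ η k := by
  simp [rightFlux, passObs_apply, qCount_apply]

theorem leftFlux_apply (hq : 0 < q ∧ q < 1) (s : ℝ) (M : ℕ) (j : ℤ) (η : Config) :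
    leftFlux hq s M j η = (1 - q ^ η j) * ∏ k ∈ Finset.Ico (-(M : ℤ)) j, s ^ 2 * q ^ η k := by
  simp [leftFlux, passObs_apply, qCount_apply]

/-- Moving each jump off `f` leaves `f` times the total of reversed minus forward rates, which
telescopes to the two boundary fluxes. -/
theorem integral_genOn_eq (hq : 0 < q ∧ q < 1) (hs : -1 < s ∧ s < 0) (hc : 0 ≤ c ∧ c < 1) (M : ℕ)
    (f : Obs) : ∫ η, genOn (jumpRate hq s ξ) (boxPairs M) f η ∂(productMeasure q s c) =
      (ξ * (-s)) * ∫ η, (f * (∑ j ∈ box M, rightFlux hq s M j - ∑ j ∈ box M, leftFlux hq s M j)) η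
        ∂(productMeasure q s c) := by
  have := isProbabilityMeasure_productMeasure hq hs hc
  have h1 : genOn (jumpRate hq s ξ) (boxPairs M) f = ∑ p ∈ boxPairs M,
      (jumpRate hq s ξ p * jumpObs f p - jumpRate hq s ξ p * f) := by
    ext η
    rw [genOn_apply, BoundedContinuousFunction.coe_sum, Finset.sum_apply]
    exact Finset.sum_congr rfl fun p _ => mul_sub _ _ _
  have hsum : ∑ p ∈ boxPairs M, (reversedRate hq s ξ p - jumpRate hq s ξ p) = (ξ * (-s)) •
      (∑ j ∈ box M, rightFlux hq s M j - ∑ j ∈ box M, leftFlux hq s M j) := by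
    have h := sum_reversed_sub_rates (qCount hq) (fun k => (s ^ 2) • qCount hq k) M
    have h' : ∑ j ∈ box M, rightFlux hq s M j - ∑ j ∈ box M, leftFlux hq s M j = _ := h.symm
    rw [h', Finset.smul_sum]
    refine Finset.sum_congr rfl fun p _ => ?_
    rw [reversedRate, jumpRate]
    split_ifs
    · ext η
      simp [passObs]
      ring
    · simp
  calc _ = ∑ p ∈ boxPairs M, (∫ η, (jumpRate hq s ξ p * jumpObs f p) η ∂(productMeasure q s c) -
        ∫ η, (jumpRate hq s ξ p * f) η ∂(productMeasure q s c)) := by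
        change integralFunctional (productMeasure q s c) (genOn _ _ f) = _
        rw [h1, map_sum]
        exact Finset.sum_congr rfl fun p _ => map_sub (integralFunctional _) _ _
    _ = ∑ p ∈ boxPairs M, integralFunctional (productMeasure q s c)
          ((reversedRate hq s ξ p - jumpRate hq s ξ p) * f) := by
        refine Finset.sum_congr rfl fun p _ => ?_
        rw [integral_jumpRate_mul_jumpObs hq hs hc, sub_mul, map_sub]
        rfl
    _ = integralFunctional (productMeasure q s c) ((ξ * (-s)) •
          (f * (∑ j ∈ box M, rightFlux hq s M j - ∑ j ∈ box M, leftFlux hq s M j))) := by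
        rw [← map_sum, ← Finset.sum_mul, hsum, smul_mul_assoc, mul_comm f]
    _ = _ := by rw [map_smul]; rfl

/-- Outside the support of `f` the fluxes through the two ends balance by reflection. -/
theorem integral_rightFlux_eq (hq : 0 < q ∧ q < 1) (hs : -1 < s ∧ s < 0) (hc : 0 ≤ c ∧ c < 1)
    {m M : ℕ} {f : Obs} (hf : f ∈ cyl m) {j : ℤ} (hj : (m : ℤ) < j) :
    ∫ η, (f * rightFlux hq s M j) η ∂(productMeasure q s c) =
      ∫ η, (f * leftFlux hq s M (-j)) η ∂(productMeasure q s c) := by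
  have := isProbabilityMeasure_siteMeasure hq hs hc
  rw [productMeasure, ← integral_outerReflection _ m]
  refine integral_congr_ae (ae_of_all _ fun η => ?_)
  have hfix : f (fun k => η (outerReflection m k)) = f η := hf fun k hk => by
    have : k.natAbs ≤ m := mem_box.1 (Finset.mem_coe.1 hk)
    simp [outerReflection, this]
  -- Since `j > m`, the source `j` and all sites of `(j, M]` lie outside `box m`, so the reflection
  -- carries them to the left end without touching the support of `f`.
  have hflip : ∀ k : ℤ, (m : ℤ) < k → outerReflection m k = -k := fun k hk => by
    have : ¬ k.natAbs ≤ m := by omega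
    simp [outerReflection, this]
  have hprod : ∏ k ∈ Finset.Ioc j (M : ℤ), s ^ 2 * q ^ η (outerReflection m k) =
      ∏ k ∈ Finset.Ico (-(M : ℤ)) (-j), s ^ 2 * q ^ η k := by
    refine Finset.prod_bij' (fun k _ => -k) (fun k _ => -k) ?_ ?_ ?_ ?_ ?_
    · intro k hk; simp only [Finset.mem_Ioc, Finset.mem_Ico] at hk ⊢; omega
    · intro k hk; simp only [Finset.mem_Ioc, Finset.mem_Ico] at hk ⊢; omega
    · simp
    · simp
    · intro k hk
      rw [hflip k (by have := (Finset.mem_Ioc.1 hk).1; omega)]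
  simp only [BoundedContinuousFunction.coe_mul, Pi.mul_apply, rightFlux_apply, leftFlux_apply,
    hfix, hprod, hflip j hj]

/-- A particle starting at or left of `m` must pass all of `(m, M]`. Enlarging `1 - q ^ η j` to `1 -
s² q ^ η j` makes the sum over sources telescope to that crossing probability. -/
theorem norm_sum_rightFlux_le (hq : 0 < q ∧ q < 1) (hs : -1 < s ∧ s < 0) {m M : ℕ} (hmM : m ≤ M) :
    ‖∑ j ∈ Finset.Icc (-(M : ℤ)) m, rightFlux hq s M j‖ ≤ (s ^ 2) ^ (M - m) := by
  rw [BoundedContinuousFunction.norm_le (by positivity)]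
  intro η
  rw [BoundedContinuousFunction.coe_sum, Finset.sum_apply]
  simp only [rightFlux_apply]
  have hx : ∀ k, 0 < q ^ η k ∧ q ^ η k ≤ 1 := fun k => rate_bounds hq _
  have hp := fun I => prod_mem_Icc hq s η I
  have hs2 := sq_lt_one_of_mem hs
  rw [Real.norm_of_nonneg (Finset.sum_nonneg fun j _ =>
    mul_nonneg (by linarith [hx j]) (hp _).1)]
  calc _ ≤ ∑ j ∈ Finset.Icc (-(M : ℤ)) m, (1 - s ^ 2 * q ^ η j) *
        ∏ k ∈ Finset.Ioc j (M : ℤ), s ^ 2 * q ^ η k := by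
        refine Finset.sum_le_sum fun j _ => mul_le_mul_of_nonneg_right ?_ (hp _).1
        have := mul_le_of_le_one_left (hx j).1.le hs2.le
        linarith
    _ = ∏ k ∈ Finset.Ioc (m : ℤ) M, s ^ 2 * q ^ η k -
        ∏ k ∈ Finset.Icc (-(M : ℤ)) M, s ^ 2 * q ^ η k :=
        sum_mul_prod_Ioc (fun k => s ^ 2 * q ^ η k) (by omega) (by omega)
    _ ≤ ∏ k ∈ Finset.Ioc (m : ℤ) M, s ^ 2 * q ^ η k := by linarith [(hp (Finset.Icc (-(M : ℤ)) M)).1]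
    _ ≤ (s ^ 2) ^ (M - m) := by
        refine (hp _).2.trans (le_of_eq ?_)
        rw [Int.card_Ioc]
        congr 1
        omega

theorem norm_sum_leftFlux_le (hq : 0 < q ∧ q < 1) (hs : -1 < s ∧ s < 0) {m M : ℕ} (hmM : m ≤ M) :
    ‖∑ j ∈ Finset.Icc (-(m : ℤ)) M, leftFlux hq s M j‖ ≤ (s ^ 2) ^ (M - m) := by
  rw [BoundedContinuousFunction.norm_le (by positivity)]
  intro η
  rw [BoundedContinuousFunction.coe_sum, Finset.sum_apply]
  simp only [leftFlux_apply]
  have hx : ∀ k, 0 < q ^ η k ∧ q ^ η k ≤ 1 := fun k => rate_bounds hq _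
  have hp := fun I => prod_mem_Icc hq s η I
  have hs2 := sq_lt_one_of_mem hs
  rw [Real.norm_of_nonneg (Finset.sum_nonneg fun j _ =>
    mul_nonneg (by linarith [hx j]) (hp _).1)]
  calc _ ≤ ∑ j ∈ Finset.Icc (-(m : ℤ)) M, (1 - s ^ 2 * q ^ η j) *
        ∏ k ∈ Finset.Ico (-(M : ℤ)) j, s ^ 2 * q ^ η k := by
        refine Finset.sum_le_sum fun j _ => mul_le_mul_of_nonneg_right ?_ (hp _).1
        have := mul_le_of_le_one_left (hx j).1.le hs2.le
        linarith
    _ = ∏ k ∈ Finset.Ico (-(M : ℤ)) (-m), s ^ 2 * q ^ η k -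
        ∏ k ∈ Finset.Icc (-(M : ℤ)) M, s ^ 2 * q ^ η k :=
        sum_mul_prod_Ico (fun k => s ^ 2 * q ^ η k) (by omega) (by omega)
    _ ≤ ∏ k ∈ Finset.Ico (-(M : ℤ)) (-m), s ^ 2 * q ^ η k := by
        linarith [(hp (Finset.Icc (-(M : ℤ)) M)).1]
    _ ≤ (s ^ 2) ^ (M - m) := by
        refine (hp _).2.trans (le_of_eq ?_)
        rw [Int.card_Ico]
        congr 1
        omega

/-- Sources are split at the edge of the support of `f`: the outer parts `U'` and `V'` have equal
integrals against `f` by reflection, and the inner parts `U` and `V` are exponentially small in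
norm. -/
theorem abs_integral_genOn_le (hq : 0 < q ∧ q < 1) (hs : -1 < s ∧ s < 0) (hξ : 0 < ξ)
    (hc : 0 ≤ c ∧ c < 1) {m M : ℕ} (hmM : m ≤ M) {f : Obs} (hf : f ∈ cyl m) :
    |∫ η, genOn (jumpRate hq s ξ) (boxPairs M) f η ∂(productMeasure q s c)| ≤
      (ξ * (-s)) * (2 * ‖f‖ * (s ^ 2) ^ (M - m)) := by
  have := isProbabilityMeasure_productMeasure hq hs hc
  set μ := productMeasure q s c
  have ha : 0 ≤ ξ * (-s) := mul_nonneg hξ.le (by linarith [hs.2])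
  rw [integral_genOn_eq hq hs hc, abs_mul, abs_of_nonneg ha]
  refine mul_le_mul_of_nonneg_left ?_ ha
  set U := ∑ j ∈ Finset.Icc (-(M : ℤ)) m, rightFlux hq s M j
  set V := ∑ j ∈ Finset.Icc (-(m : ℤ)) M, leftFlux hq s M j
  set U' := ∑ j ∈ Finset.Ioc (m : ℤ) M, rightFlux hq s M j with hU'
  set V' := ∑ j ∈ Finset.Ico (-(M : ℤ)) (-m), leftFlux hq s M j with hV'
  have hU : ∑ j ∈ box M, rightFlux hq s M j = U + U' := by
    have h : box M = Finset.Icc (-(M : ℤ)) m ∪ Finset.Ioc (m : ℤ) M := by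
      ext k; simp only [box, Finset.mem_union, Finset.mem_Icc, Finset.mem_Ioc]; omega
    rw [h, Finset.sum_union]
    rw [Finset.disjoint_left]
    intro k hk hk'
    simp only [Finset.mem_Icc, Finset.mem_Ioc] at hk hk'
    omega
  have hV : ∑ j ∈ box M, leftFlux hq s M j = V + V' := by
    have h : box M = Finset.Icc (-(m : ℤ)) M ∪ Finset.Ico (-(M : ℤ)) (-m) := by
      ext k; simp only [box, Finset.mem_union, Finset.mem_Icc, Finset.mem_Ico]; omega
    rw [h, Finset.sum_union]
    rw [Finset.disjoint_left]
    intro k hk hk'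
    simp only [Finset.mem_Icc, Finset.mem_Ico] at hk hk'
    omega
  have hbal : integralFunctional μ (f * U') = integralFunctional μ (f * V') := by
    rw [hU', hV', Finset.mul_sum, Finset.mul_sum, map_sum, map_sum]
    refine Finset.sum_bij' (fun k _ => -k) (fun k _ => -k) ?_ ?_ ?_ ?_ ?_
    · intro k hk; simp only [Finset.mem_Ioc, Finset.mem_Ico] at hk ⊢; omega
    · intro k hk; simp only [Finset.mem_Ioc, Finset.mem_Ico] at hk ⊢; omega
    · simp
    · simp
    · intro k hk
      exact integral_rightFlux_eq hq hs hc hf (Finset.mem_Ioc.1 hk).1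
  change |integralFunctional μ (f * _)| ≤ _
  have e : f * (∑ j ∈ box M, rightFlux hq s M j - ∑ j ∈ box M, leftFlux hq s M j) =
      f * U - f * V + (f * U' - f * V') := by rw [hU, hV]; ring
  rw [e, map_add, map_sub _ (f * U'), hbal, sub_self, add_zero]
  have hn1 := norm_sum_rightFlux_le hq hs hmM
  have hn2 := norm_sum_leftFlux_le hq hs hmM
  calc _ ≤ ‖f * U - f * V‖ := abs_integralFunctional_le μ _
    _ ≤ ‖f * U‖ + ‖f * V‖ := norm_sub_le _ _
    _ ≤ ‖f‖ * (s ^ 2) ^ (M - m) + ‖f‖ * (s ^ 2) ^ (M - m) :=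
        add_le_add ((norm_mul_le _ _).trans (mul_le_mul_of_nonneg_left hn1 (norm_nonneg _)))
          ((norm_mul_le _ _).trans (mul_le_mul_of_nonneg_left hn2 (norm_nonneg _)))
    _ = _ := by ring

theorem tendsto_integral_genOn (hq : 0 < q ∧ q < 1) (hs : -1 < s ∧ s < 0) (hξ : 0 < ξ)
    (hc : 0 ≤ c ∧ c < 1) {m : ℕ} {f : Obs} (hf : f ∈ cyl m) :
    Tendsto (fun M => ∫ η, genOn (jumpRate hq s ξ) (boxPairs M) f η ∂(productMeasure q s c)) atTop
      (𝓝 0) := by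
  refine squeeze_zero_norm' ((eventually_ge_atTop m).mono fun M hM =>
    abs_integral_genOn_le hq hs hξ hc hM hf) ?_
  have h := (tendsto_pow_atTop_nhds_zero_of_lt_one (sq_nonneg s) (sq_lt_one_of_mem hs)).comp
    (tendsto_sub_atTop_nat m)
  simpa using (h.const_mul (2 * ‖f‖)).const_mul (ξ * (-s))

end Stationarity

/-! ### Assembling existence, uniqueness and stationarity -/

theorem isTransitionSemigroup_limitKernel {q s ξ : ℝ} (hq : 0 < q ∧ q < 1) (hs : -1 < s ∧ s < 0)
    (hξ : 0 < ξ) : IsTransitionSemigroup q s ξ (limitKernel (isJumpRate_jumpRate hq hs hξ)) where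
  markov := isMarkovKernel_limitKernel _
  zero := limitKernel_zero _
  add := limitKernel_add _
  forward f hf η t := by
    obtain ⟨m, F, hF, rfl⟩ := hf.exists_mem_cyl
    rw [generator_eq_genAll hq]
    have h := hasDerivWithinAt_integral_lawAt (isJumpRate_jumpRate hq hs hξ) η hF t.2
    have e : lawAt (isJumpRate_jumpRate hq hs hξ) η t =
        limitKernel (isJumpRate_jumpRate hq hs hξ) t η := by
      rw [lawAt, Real.toNNReal_coe]
    rw [← e]
    exact h

theorem IsTransitionSemigroup.eq_limitKernel {q s ξ : ℝ} (hq : 0 < q ∧ q < 1)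
    (hs : -1 < s ∧ s < 0) (hξ : 0 < ξ) {P : ℝ≥0 → Kernel Config Config}
    (hP : IsTransitionSemigroup q s ξ P) : P = limitKernel (isJumpRate_jumpRate hq hs hξ) :=
  eq_limitKernel_of_forward _ hP.markov hP.zero fun m f hf η t => by
    rw [← generator_eq_genAll]
    exact hP.forward f (isBoundedCylinder_of_mem_cyl hf) η t

end HalfContinuousVertex

end

theorem propositionB1 (q s ξ c : ℝ) (hq : 0 < q ∧ q < 1) (hs : -1 < s ∧ s < 0) (hξ : 0 < ξ)
    (hc : 0 ≤ c ∧ c < 1) :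
    ((∀ j, 0 ≤ HalfContinuousVertex.siteWeight q s c j) ∧
      HasSum (HalfContinuousVertex.siteWeight q s c) 1) ∧
    IsProbabilityMeasure (HalfContinuousVertex.siteMeasure q s c) ∧
    ∃ P : ℝ≥0 → Kernel HalfContinuousVertex.Config HalfContinuousVertex.Config,
      HalfContinuousVertex.IsTransitionSemigroup q s ξ P ∧
      (∀ P', HalfContinuousVertex.IsTransitionSemigroup q s ξ P' → P' = P) ∧
      ∀ t : ℝ≥0, Kernel.Invariant (P t) (HalfContinuousVertex.productMeasure q s c) := by
  have := HalfContinuousVertex.isProbabilityMeasure_productMeasure hq hs hc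
  exact ⟨⟨HalfContinuousVertex.siteWeight_nonneg hq hs hc,
      HalfContinuousVertex.hasSum_siteWeight hq hs hc⟩,
    HalfContinuousVertex.isProbabilityMeasure_siteMeasure hq hs hc,
    HalfContinuousVertex.limitKernel (HalfContinuousVertex.isJumpRate_jumpRate hq hs hξ),
    HalfContinuousVertex.isTransitionSemigroup_limitKernel hq hs hξ,
    fun _ hP => hP.eq_limitKernel hq hs hξ,
    HalfContinuousVertex.invariant_limitKernel _ _ fun _ _ hf =>
      HalfContinuousVertex.tendsto_integral_genOn hq hs hξ hc hf⟩
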